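/- Lemma 1 (Approximate matrix Bernstein's inequality). Let $d\ge 2$ and $m\ge 1$ be integers and let $Y_1,\dots,Y_m$ be independent random real symmetric $d\times d$ matrices. Write $\|A\|$ for the spectral norm (the operator norm on Euclidean $\mathbb{R}^d$) of a matrix $A$, and $|A|$ for the matrix of the absolute values of the entries of $A$. Suppose that there is a real number $R>0$ such that, for every $k=1,\dots,m$, $\|\,|Y_k|\,\|\le R$ almost surely and the (entrywise) expectation $\epsilon_k=E(Y_k)$ satisfies $\|\,|\epsilon_k|\,\|\le R/m$. Define $\sigma^2=\left\|\sum_{k=1}^m E(Y_k^2)\right\|$. Then $\left\|\sum_{k=1}^m Y_k\right\|$ is integrable and $$E\left\|\sum_{k=1}^m Y_k\right\|\le \frac{R\log d}{\sqrt2}+\sqrt2\,R^2+\sqrt{(R+\log d)\left(3\sigma^2+2R^3+7R^2+\sqrt2\,R^2+\frac{7R^2}{m}+\frac{4R^2}{m^2}\right)}.$$ -/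

import Mathlib

open MeasureTheory ProbabilityTheory

/- On real matrices, `‖A‖` is the spectral norm: the operator norm of `A` acting on Euclidean
space. -/
open scoped Matrix.Norms.L2Operator

/-- Real matrices carry the product σ-algebra of their entries. -/
instance Matrix.instMeasurableSpaceEntries {d : ℕ} :
    MeasurableSpace (Matrix (Fin d) (Fin d) ℝ) :=
  inferInstanceAs (MeasurableSpace (Fin d → Fin d → ℝ))

/-- The entrywise absolute value `|A|` of a real matrix. -/
def Matrix.entryAbs {d : ℕ} (A : Matrix (Fin d) (Fin d) ℝ) : Matrix (Fin d) (Fin d) ℝ :=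
  A.map (fun x => |x|)

/-- The expectation of a random matrix, taken entry by entry. -/
noncomputable def matrixExpectation {Ω : Type*} [MeasurableSpace Ω] (μ : Measure Ω) {d : ℕ}
    (Y : Ω → Matrix (Fin d) (Fin d) ℝ) : Matrix (Fin d) (Fin d) ℝ :=
  Matrix.of (fun i j => ∫ ω, Y ω i j ∂μ)

/-!
The means cost little: `‖∑ εₖ‖ ≤ R`, so the matter is the norm of `S = ∑ Xₖ` for the centered
matrices `Xₖ = Yₖ - εₖ`, which are bounded by `L = R (1 + 1/m)` and have matrix variance
`V = ∑ E Xₖ² ≤ ∑ E Yₖ²`, hence `V ≤ σ²` in the Loewner order.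

The norm of `S` is controlled by traces `E tr F(S)` through the method of exchangeable pairs.
Replacing a single `Xₖ` by an independent copy, with all other summands fixed, writes
`E tr (Xₖ F(S))` as half the mean of `tr ((Xₖ - Xₖ') (F(S) - F(S')))`, and the mean value trace
inequality `IsSpectral.trace_mul_sub_le` bounds that by
`E tr ((Xₖ - Xₖ')² (H(S) + H(S'))) / 4`, where `H` is essentially `F'`. Summation over `k` gives
`E tr (S F(S)) ≤ E tr ((Q + V) H(S)) / 2` with `Q = ∑ Xₖ²`
(`IsCenteredFamily.integral_trace_mul_le`). The same argument applied to `Xₖ² - E Xₖ²` in place of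
`Xₖ` bounds `E tr ((Q - V) F(S))` by `(L / √2) E tr ((Q + V) H(S))`
(`IsCenteredFamily.integral_trace_sq_sub_mul_le`), so that `Q` may be traded for `V`.

* For `F(A) = exp (θ A)` the two inequalities together become the differential inequality
  `m' ≤ θ σ² / (1 - θ L / √2) m` for `m(θ) = E tr exp (θ S)`. Integrating it and optimizing `θ`
  yields `E ‖S‖ ≤ √(2 σ² log (2 d)) + (L / √2) log (2 d)` (`IsCenteredFamily.integral_norm_le`).
* The factor `log (2 d)` is too large against `3 σ² log d` in low dimension. There the choices
  `F(A) = A` and `F(A) = A³` give second and fourth trace moments with Gaussian constants, which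
  suffice as long as `d ≤ 3 log d`, respectively `d ≤ 3 (log d)²`.

The ranges `2 ≤ d ≤ 4`, `5 ≤ d ≤ 23` and `24 ≤ d` of the second, fourth and exponential moments
are put together in `integral_norm_centered_add_le`.
-/

/-! ### Trace inequalities for symmetric matrices -/

namespace Matrix

section Deterministic

variable {n : Type*} [Fintype n] [DecidableEq n]

/-- `F` acts on real symmetric matrices as the functional calculus of `f : ℝ → ℝ`: it applies `f`
to the eigenvalues in any orthogonal diagonalization. -/
def IsSpectral (F : Matrix n n ℝ → Matrix n n ℝ) (f : ℝ → ℝ) : Prop :=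
  ∀ (U : Matrix n n ℝ) (α : n → ℝ), Uᵀ * U = 1 →
    F (U * diagonal α * Uᵀ) = U * diagonal (f ∘ α) * Uᵀ

lemma IsSymm.exists_diagonalization {A : Matrix n n ℝ} (hA : A.IsSymm) :
    ∃ (U : Matrix n n ℝ) (α : n → ℝ), Uᵀ * U = 1 ∧ A = U * diagonal α * Uᵀ := by
  have hH : A.IsHermitian := by
    rw [IsHermitian, conjTranspose_eq_transpose_of_trivial]; exact hA
  refine ⟨hH.eigenvectorUnitary, hH.eigenvalues, ?_, ?_⟩
  · have := Unitary.coe_star_mul_self hH.eigenvectorUnitary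
    rwa [star_eq_conjTranspose, conjTranspose_eq_transpose_of_trivial] at this
  · have := hH.spectral_theorem
    rw [Unitary.conjStarAlgAut_apply, star_eq_conjTranspose,
      conjTranspose_eq_transpose_of_trivial] at this
    exact this

lemma trace_mul_conj_diagonal (C U : Matrix n n ℝ) (g : n → ℝ) :
    trace (C * (U * diagonal g * Uᵀ)) = ∑ i, g i * (Uᵀ * C * U) i i := by
  have : trace (C * (U * diagonal g * Uᵀ)) = trace ((Uᵀ * C * U) * diagonal g) := by
    rw [← Matrix.mul_assoc, trace_mul_comm]; simp only [Matrix.mul_assoc]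
  rw [this, trace]
  exact Finset.sum_congr rfl fun i _ => by rw [diag_apply, mul_diagonal, mul_comm]

/-- The trace of a product of two positive semidefinite matrices is nonnegative. -/
lemma PosSemidef.trace_mul_nonneg {P G : Matrix n n ℝ} (hP : P.PosSemidef)
    (hG : G.PosSemidef) : 0 ≤ trace (P * G) := by
  have hs : G.IsSymm := by
    have := hG.1; rwa [IsHermitian, conjTranspose_eq_transpose_of_trivial] at this
  obtain ⟨U, α, hU, rfl⟩ := hs.exists_diagonalization
  have h1 : diagonal α = Uᵀ * (U * diagonal α * Uᵀ) * U := by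
    calc diagonal α = (Uᵀ * U) * diagonal α * (Uᵀ * U) := by rw [hU]; simp
      _ = _ := by simp only [Matrix.mul_assoc]
  have h2 : (diagonal α).PosSemidef := by
    rw [h1]; simpa using hG.conjTranspose_mul_mul_same U
  rw [trace_mul_conj_diagonal]
  refine Finset.sum_nonneg fun i _ => mul_nonneg (by simpa using h2.diag_nonneg (i := i)) ?_
  have h3 : (Uᵀ * P * U).PosSemidef := by simpa using hP.conjTranspose_mul_mul_same U
  exact h3.diag_nonneg

lemma trace_mul_le_trace_mul {P Q G : Matrix n n ℝ} (hPQ : (Q - P).PosSemidef)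
    (hG : G.PosSemidef) : trace (P * G) ≤ trace (Q * G) := by
  have := hPQ.trace_mul_nonneg hG
  rw [Matrix.sub_mul, trace_sub] at this
  linarith

lemma IsSymm.posSemidef_sq {A : Matrix n n ℝ} (hA : A.IsSymm) : (A ^ 2).PosSemidef := by
  have := posSemidef_conjTranspose_mul_self A
  rwa [conjTranspose_eq_transpose_of_trivial, hA.eq, ← sq] at this

lemma IsSymm.posSemidef_smul_one_sub {A : Matrix n n ℝ} (hA : A.IsSymm) {c : ℝ}
    (hc : ‖A‖ ≤ c) : (c • (1 : Matrix n n ℝ) - A).PosSemidef := by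
  refine PosSemidef.of_dotProduct_mulVec_nonneg ?_ fun x => ?_
  · rw [IsHermitian, conjTranspose_eq_transpose_of_trivial]
    simp [hA.eq]
  · set y : EuclideanSpace ℝ n := WithLp.toLp 2 x with hy
    have h1 := inner_toEuclideanCLM A y y
    have h2 : x ⬝ᵥ x = ‖y‖ ^ 2 := by
      rw [EuclideanSpace.norm_sq_eq]; simp [dotProduct, hy, sq]
    have h3 : inner ℝ y (toEuclideanCLM (𝕜 := ℝ) A y) ≤ c * ‖y‖ ^ 2 := by
      calc _ ≤ ‖y‖ * ‖toEuclideanCLM (𝕜 := ℝ) A y‖ := real_inner_le_norm _ _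
        _ ≤ ‖y‖ * (‖A‖ * ‖y‖) := by
          gcongr; exact (toEuclideanCLM (𝕜 := ℝ) A).le_opNorm y
        _ ≤ ‖y‖ * (c * ‖y‖) := by gcongr
        _ = _ := by ring
    have h4 : (c • (1 : Matrix n n ℝ) - A) *ᵥ x = c • x - A *ᵥ x := by
      rw [sub_mulVec, smul_mulVec, one_mulVec]
    rw [h4, star_trivial, dotProduct_sub, dotProduct_smul, h2, smul_eq_mul]
    have h5 : inner ℝ y (toEuclideanCLM (𝕜 := ℝ) A y) = x ⬝ᵥ A *ᵥ x := h1
    linarith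

/-- `tr (A G) ≤ ‖A‖ tr G` for positive semidefinite `G`. -/
lemma IsSymm.trace_mul_le {A G : Matrix n n ℝ} (hA : A.IsSymm) {c : ℝ} (hc : ‖A‖ ≤ c)
    (hG : G.PosSemidef) : trace (A * G) ≤ c * trace G := by
  have := trace_mul_le_trace_mul (hA.posSemidef_smul_one_sub hc) hG
  simpa [trace_smul] using this

lemma IsSpectral.posSemidef {F : Matrix n n ℝ → Matrix n n ℝ} {f : ℝ → ℝ} (hF : IsSpectral F f)
    (hf : ∀ t, 0 ≤ f t) {A : Matrix n n ℝ} (hA : A.IsSymm) : (F A).PosSemidef := by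
  obtain ⟨U, α, hU, rfl⟩ := hA.exists_diagonalization
  rw [hF U α hU]
  have : (diagonal (f ∘ α)).PosSemidef := PosSemidef.diagonal fun i => hf _
  simpa using this.mul_mul_conjTranspose_same U

lemma IsSpectral.add {F G : Matrix n n ℝ → Matrix n n ℝ} {f g : ℝ → ℝ} (hF : IsSpectral F f)
    (hG : IsSpectral G g) : IsSpectral (fun A => F A + G A) (fun t => f t + g t) := by
  intro U α hU
  have : diagonal ((fun t => f t + g t) ∘ α) = diagonal (f ∘ α) + diagonal (g ∘ α) := by
    rw [diagonal_add]; rfl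
  simp only [hF U α hU, hG U α hU, this, Matrix.mul_add, Matrix.add_mul]

lemma IsSpectral.const_smul {F : Matrix n n ℝ → Matrix n n ℝ} {f : ℝ → ℝ} (hF : IsSpectral F f)
    (c : ℝ) : IsSpectral (fun A => c • F A) (fun t => c * f t) := by
  intro U α hU
  have : diagonal ((fun t => c * f t) ∘ α) = c • diagonal (f ∘ α) := by
    rw [← diagonal_smul]; rfl
  simp only [hF U α hU, this, Matrix.mul_smul, Matrix.smul_mul]

lemma isSpectral_pow (k : ℕ) :
    IsSpectral (fun A : Matrix n n ℝ => A ^ k) (fun t => t ^ k) := by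
  intro U α hU
  have hU' : U * Uᵀ = 1 := mul_eq_one_comm.mp hU
  have key : ∀ k : ℕ, (U * diagonal α * Uᵀ) ^ k = U * (diagonal α) ^ k * Uᵀ := by
    intro k
    induction k with
    | zero => simp [hU']
    | succ k ih =>
      rw [pow_succ, ih, pow_succ]
      calc U * diagonal α ^ k * Uᵀ * (U * diagonal α * Uᵀ)
          = U * diagonal α ^ k * (Uᵀ * U) * diagonal α * Uᵀ := by simp only [Matrix.mul_assoc]
        _ = _ := by rw [hU]; simp only [Matrix.mul_assoc, Matrix.one_mul]
  simp only [key, diagonal_pow]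
  rfl

lemma isSpectral_exp (θ : ℝ) :
    IsSpectral (fun A : Matrix n n ℝ => NormedSpace.exp (θ • A)) (fun t => Real.exp (θ * t)) := by
  intro U α hU
  have hU' : U * Uᵀ = 1 := mul_eq_one_comm.mp hU
  have hinv : U⁻¹ = Uᵀ := inv_eq_right_inv hU'
  have hunit : IsUnit U := ⟨⟨U, Uᵀ, hU', hU⟩, rfl⟩
  have h1 : θ • (U * diagonal α * Uᵀ) = U * diagonal (θ • α) * U⁻¹ := by
    rw [hinv, diagonal_smul, Matrix.mul_smul, Matrix.smul_mul]
  have h2 : NormedSpace.exp (θ • α) = (fun t => Real.exp (θ * t)) ∘ α := by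
    ext i
    rw [Pi.coe_exp]
    simp [Real.exp_eq_exp_ℝ]
  simp only [h1]
  rw [exp_conj _ _ hunit, exp_diagonal, h2, hinv]

/-- A function of the norm that is dominated by a nonnegative `f` on the eigenvalues is dominated
by the trace: the norm of a symmetric matrix is the modulus of one of its eigenvalues. -/
lemma IsSpectral.le_trace [Nonempty n] {F : Matrix n n ℝ → Matrix n n ℝ} {f φ : ℝ → ℝ}
    (hF : IsSpectral F f) (hf : ∀ t, 0 ≤ f t) (hφ : ∀ t, φ |t| ≤ f t) {A : Matrix n n ℝ}
    (hA : A.IsSymm) : φ ‖A‖ ≤ trace (F A) := by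
  obtain ⟨U, α, hU, rfl⟩ := hA.exists_diagonalization
  have hU' : U * Uᵀ = 1 := mul_eq_one_comm.mp hU
  have hmem : U ∈ unitary (Matrix n n ℝ) := by
    rw [Unitary.mem_iff, star_eq_conjTranspose, conjTranspose_eq_transpose_of_trivial]
    exact ⟨hU, hU'⟩
  have hnorm : ‖U * diagonal α * Uᵀ‖ = ‖α‖ := by
    have h1 := CStarRing.norm_coe_unitary_mul ⟨U, hmem⟩ (diagonal α * Uᵀ)
    have h2 := CStarRing.norm_mul_coe_unitary (diagonal α) (star ⟨U, hmem⟩)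
    rw [Unitary.coe_star, star_eq_conjTranspose, conjTranspose_eq_transpose_of_trivial] at h2
    rw [Matrix.mul_assoc, h1, h2, l2_opNorm_diagonal]
  obtain ⟨i, hi⟩ : ∃ i, ‖α‖ = |α i| := by
    obtain ⟨i, -, hi⟩ := Finset.exists_max_image Finset.univ (fun i => |α i|)
      Finset.univ_nonempty
    refine ⟨i, le_antisymm ?_ (norm_le_pi_norm α i)⟩
    exact (pi_norm_le_iff_of_nonneg (abs_nonneg _)).2 fun j => hi j (Finset.mem_univ j)
  have htr : trace (F (U * diagonal α * Uᵀ)) = ∑ i, f (α i) := by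
    have := trace_mul_conj_diagonal 1 U (f ∘ α)
    rw [hF U α hU, ← Matrix.one_mul (U * diagonal (f ∘ α) * Uᵀ), this]
    simp [hU]
  rw [htr, hnorm, hi]
  exact (hφ _).trans (Finset.single_le_sum (f := fun i => f (α i)) (fun j _ => hf _)
    (Finset.mem_univ i))

/-- **Mean value trace inequality.** In a pair of eigenbases of `A` and `B`, the entries of
`F A - F B` are those of `A - B` multiplied by difference quotients of `f`; these are at most the
averages of `h`, and the weighted inequality `2 |c e| ≤ a c² + a⁻¹ e²` separates `C`
from `A - B`. -/
theorem IsSpectral.trace_mul_sub_le {F H : Matrix n n ℝ → Matrix n n ℝ} {f h : ℝ → ℝ}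
    (hF : IsSpectral F f) (hH : IsSpectral H h)
    (hfh : ∀ s t, |f s - f t| ≤ |s - t| * ((h s + h t) / 2)) (hh : ∀ t, 0 ≤ h t)
    {A B C : Matrix n n ℝ}
    (hA : A.IsSymm) (hB : B.IsSymm) (hC : C.IsSymm) {a : ℝ} (ha : 0 < a) :
    trace (C * (F A - F B)) ≤
      1 / 4 * trace ((a • C ^ 2 + a⁻¹ • (A - B) ^ 2) * (H A + H B)) := by
  have hD : (A - B).IsSymm := hA.sub hB
  obtain ⟨D, hDdef⟩ : ∃ D, D = A - B := ⟨_, rfl⟩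
  rw [← hDdef] at hD ⊢
  obtain ⟨U, α, hU, rfl⟩ := hA.exists_diagonalization
  obtain ⟨W, β, hW, rfl⟩ := hB.exists_diagonalization
  have hU' : U * Uᵀ = 1 := mul_eq_one_comm.mp hU
  have hW' : W * Wᵀ = 1 := mul_eq_one_comm.mp hW
  set G := Uᵀ * W with hG
  -- the entries of the matrices in the pair of eigenbases
  have hG_D : ∀ i j, (Uᵀ * D * W) i j = (α i - β j) * G i j := by
    intro i j
    have : Uᵀ * D * W = diagonal α * G - G * diagonal β := by
      rw [hDdef, Matrix.mul_sub, Matrix.sub_mul, hG]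
      congr 1
      · calc Uᵀ * (U * diagonal α * Uᵀ) * W = (Uᵀ * U) * diagonal α * (Uᵀ * W) := by
              simp only [Matrix.mul_assoc]
          _ = _ := by rw [hU, Matrix.one_mul]
      · calc Uᵀ * (W * diagonal β * Wᵀ) * W = (Uᵀ * W) * diagonal β * (Wᵀ * W) := by
              simp only [Matrix.mul_assoc]
          _ = _ := by rw [hW, Matrix.mul_one]
    rw [this, sub_apply, diagonal_mul, mul_diagonal]; ring
  have hsq_U : ∀ (K : Matrix n n ℝ), K.IsSymm → ∀ g : n → ℝ,
      trace (K ^ 2 * (U * diagonal g * Uᵀ)) = ∑ i, ∑ j, g i * (Uᵀ * K * W) i j ^ 2 := by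
    intro K hK g
    rw [trace_mul_conj_diagonal]
    refine Finset.sum_congr rfl fun i _ => ?_
    have : Uᵀ * K ^ 2 * U = (Uᵀ * K * W) * (Uᵀ * K * W)ᵀ := by
      simp only [transpose_mul, transpose_transpose, hK.eq]
      calc Uᵀ * K ^ 2 * U = Uᵀ * K * 1 * K * U := by
            rw [Matrix.mul_one, sq]; simp only [Matrix.mul_assoc]
        _ = _ := by rw [← hW']; simp only [Matrix.mul_assoc]
    rw [this, mul_apply, Finset.mul_sum]
    exact Finset.sum_congr rfl fun j _ => by rw [transpose_apply, sq]
  have hsq_W : ∀ (K : Matrix n n ℝ), K.IsSymm → ∀ g : n → ℝ,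
      trace (K ^ 2 * (W * diagonal g * Wᵀ)) = ∑ i, ∑ j, g j * (Uᵀ * K * W) i j ^ 2 := by
    intro K hK g
    rw [trace_mul_conj_diagonal, Finset.sum_comm]
    refine Finset.sum_congr rfl fun i _ => ?_
    have : Wᵀ * K ^ 2 * W = (Uᵀ * K * W)ᵀ * (Uᵀ * K * W) := by
      simp only [transpose_mul, transpose_transpose, hK.eq]
      calc Wᵀ * K ^ 2 * W = Wᵀ * K * 1 * K * W := by
            rw [Matrix.mul_one, sq]; simp only [Matrix.mul_assoc]
        _ = _ := by rw [← hU']; simp only [Matrix.mul_assoc]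
    rw [this, mul_apply, Finset.mul_sum]
    exact Finset.sum_congr rfl fun j _ => by rw [transpose_apply, sq]
  have hC_U : ∀ g : n → ℝ, trace (C * (U * diagonal g * Uᵀ)) =
      ∑ i, ∑ j, g i * ((Uᵀ * C * W) i j * G i j) := by
    intro g
    rw [trace_mul_conj_diagonal]
    refine Finset.sum_congr rfl fun i _ => ?_
    have : Uᵀ * C * U = (Uᵀ * C * W) * Gᵀ := by
      rw [hG, transpose_mul, transpose_transpose]
      calc Uᵀ * C * U = Uᵀ * C * 1 * U := by rw [Matrix.mul_one]
        _ = _ := by rw [← hW']; simp only [Matrix.mul_assoc]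
    rw [this, mul_apply, Finset.mul_sum]
    exact Finset.sum_congr rfl fun j _ => by rw [transpose_apply]
  have hC_W : ∀ g : n → ℝ, trace (C * (W * diagonal g * Wᵀ)) =
      ∑ i, ∑ j, g j * ((Uᵀ * C * W) i j * G i j) := by
    intro g
    rw [trace_mul_conj_diagonal, Finset.sum_comm]
    refine Finset.sum_congr rfl fun i _ => ?_
    have : Wᵀ * C * W = Gᵀ * (Uᵀ * C * W) := by
      rw [hG, transpose_mul, transpose_transpose]
      calc Wᵀ * C * W = Wᵀ * 1 * C * W := by rw [Matrix.mul_one]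
        _ = _ := by rw [← hU']; simp only [Matrix.mul_assoc]
    rw [this, mul_apply, Finset.mul_sum]
    exact Finset.sum_congr rfl fun j _ => by rw [transpose_apply]; ring
  rw [hF U α hU, hF W β hW, hH U α hU, hH W β hW]
  simp only [Matrix.mul_sub, Matrix.mul_add, Matrix.add_mul, trace_add, trace_sub,
    Matrix.smul_mul, trace_smul, hsq_U C hC, hsq_U D hD, hsq_W C hC, hsq_W D hD, hC_U, hC_W]
  simp only [smul_eq_mul, Finset.mul_sum, ← Finset.sum_add_distrib, ← Finset.sum_sub_distrib]
  refine Finset.sum_le_sum fun i _ => Finset.sum_le_sum fun j _ => ?_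
  set c := (Uᵀ * C * W) i j
  rw [hG_D i j]
  simp only [Function.comp_apply]
  set s := α i
  set t := β j
  set g := G i j
  have h1 : (f s - f t) * (c * g) ≤ (h s + h t) / 2 * (|c| * |(s - t) * g|) := by
    calc (f s - f t) * (c * g) ≤ |(f s - f t) * (c * g)| := le_abs_self _
      _ = |f s - f t| * (|c| * |g|) := by rw [abs_mul, abs_mul]
      _ ≤ (|s - t| * ((h s + h t) / 2)) * (|c| * |g|) := by gcongr; exact hfh s t
      _ = _ := by rw [abs_mul]; ring
  have h2 : |c| * |(s - t) * g| ≤ 1 / 2 * (a * c ^ 2 + a⁻¹ * ((s - t) * g) ^ 2) := by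
    have h3 : 0 ≤ a⁻¹ * (a * |c| - |(s - t) * g|) ^ 2 := by positivity
    have h4 : a⁻¹ * (a * |c| - |(s - t) * g|) ^ 2
        = a * |c| ^ 2 - 2 * (|c| * |(s - t) * g|) + a⁻¹ * |(s - t) * g| ^ 2 := by
      field_simp
      ring
    rw [h4, sq_abs, sq_abs] at h3
    linarith
  have h5 : 0 ≤ (h s + h t) / 2 := by linarith [hh s, hh t]
  have h6 := mul_le_mul_of_nonneg_left h2 h5
  nlinarith [h1, h6]

/-- The spectral norm is dominated by that of the matrix of absolute values. -/
lemma norm_le_norm_entryAbs {d : ℕ} (A : Matrix (Fin d) (Fin d) ℝ) : ‖A‖ ≤ ‖A.entryAbs‖ := by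
  rw [cstar_norm_def]
  refine ContinuousLinearMap.opNorm_le_bound _ (norm_nonneg _) fun x => ?_
  set y : EuclideanSpace ℝ (Fin d) := WithLp.toLp 2 fun i => |x i| with hy
  have hxy : ‖y‖ = ‖x‖ := by
    rw [EuclideanSpace.norm_eq, EuclideanSpace.norm_eq]; simp [hy]
  have h1 : ‖toEuclideanCLM (𝕜 := ℝ) A x‖ ≤ ‖toEuclideanCLM (𝕜 := ℝ) A.entryAbs y‖ := by
    rw [EuclideanSpace.norm_eq, EuclideanSpace.norm_eq]
    refine Real.sqrt_le_sqrt (Finset.sum_le_sum fun i _ => ?_)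
    simp only [ofLp_toEuclideanCLM, Real.norm_eq_abs]
    refine pow_le_pow_left₀ (abs_nonneg _) (le_trans ?_ (le_abs_self _)) 2
    simp only [mulVec, dotProduct, entryAbs, map_apply, hy]
    refine (Finset.abs_sum_le_sum_abs _ _).trans (Finset.sum_le_sum fun j _ => ?_)
    rw [abs_mul]
  refine h1.trans ?_
  rw [← hxy]
  exact (toEuclideanCLM (𝕜 := ℝ) A.entryAbs).le_opNorm y

end Deterministic

end Matrix

/-! ### Bounded random matrices -/

namespace Matrix

section Bounded

variable {d : ℕ} {Ω : Type*} [MeasurableSpace Ω]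

instance instBorelSpaceEntries : BorelSpace (Matrix (Fin d) (Fin d) ℝ) :=
  inferInstanceAs (BorelSpace (Fin d → Fin d → ℝ))

/-- A random matrix that is measurable and uniformly bounded (everywhere, not only almost
everywhere). -/
structure IsBddMeas (X : Ω → Matrix (Fin d) (Fin d) ℝ) : Prop where
  measurable : Measurable X
  bdd : ∃ K, ∀ ω, ‖X ω‖ ≤ K

namespace IsBddMeas

variable {X Y : Ω → Matrix (Fin d) (Fin d) ℝ}

lemma comp (hX : IsBddMeas X) {F : Matrix (Fin d) (Fin d) ℝ → Matrix (Fin d) (Fin d) ℝ}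
    (hF : Continuous F) : IsBddMeas (fun ω => F (X ω)) := by
  refine ⟨hF.measurable.comp hX.measurable, ?_⟩
  obtain ⟨K, hK⟩ := hX.bdd
  have : ProperSpace (Matrix (Fin d) (Fin d) ℝ) := FiniteDimensional.proper ℝ _
  obtain ⟨K', hK'⟩ :=
    (isCompact_closedBall (0 : Matrix (Fin d) (Fin d) ℝ) K).exists_bound_of_continuousOn
    hF.continuousOn
  exact ⟨K', fun ω => hK' _ (by simpa using hK ω)⟩

lemma const (A : Matrix (Fin d) (Fin d) ℝ) : IsBddMeas (fun _ : Ω => A) :=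
  ⟨measurable_const, ‖A‖, fun _ => le_rfl⟩

lemma add (hX : IsBddMeas X) (hY : IsBddMeas Y) : IsBddMeas (fun ω => X ω + Y ω) := by
  obtain ⟨K, hK⟩ := hX.bdd
  obtain ⟨K', hK'⟩ := hY.bdd
  exact ⟨hX.measurable.add hY.measurable, K + K', fun ω => norm_add_le_of_le (hK ω) (hK' ω)⟩

lemma sub (hX : IsBddMeas X) (hY : IsBddMeas Y) : IsBddMeas (fun ω => X ω - Y ω) := by
  obtain ⟨K, hK⟩ := hX.bdd
  obtain ⟨K', hK'⟩ := hY.bdd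
  exact ⟨hX.measurable.sub hY.measurable, K + K', fun ω => norm_sub_le_of_le (hK ω) (hK' ω)⟩

lemma mul (hX : IsBddMeas X) (hY : IsBddMeas Y) : IsBddMeas (fun ω => X ω * Y ω) := by
  obtain ⟨K, hK⟩ := hX.bdd
  obtain ⟨K', hK'⟩ := hY.bdd
  exact ⟨hX.measurable.mul hY.measurable, K * K', fun ω => norm_mul_le_of_le (hK ω) (hK' ω)⟩

lemma pow (hX : IsBddMeas X) (k : ℕ) : IsBddMeas (fun ω => X ω ^ k) :=
  hX.comp (F := fun A => A ^ k) (continuous_pow k)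

lemma sum {ι : Type*} {X : ι → Ω → Matrix (Fin d) (Fin d) ℝ} (s : Finset ι)
    (hX : ∀ k, IsBddMeas (X k)) : IsBddMeas (fun ω => ∑ k ∈ s, X k ω) := by
  classical
  induction s using Finset.induction_on with
  | empty => simpa using const 0
  | insert k s hk ih => simpa [Finset.sum_insert hk] using (hX k).add ih

lemma integrable {μ : Measure Ω} [IsFiniteMeasure μ] (hX : IsBddMeas X) : Integrable X μ := by
  obtain ⟨K, hK⟩ := hX.bdd
  exact Integrable.of_bound hX.measurable.aestronglyMeasurable K (Filter.Eventually.of_forall hK)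

/-- The trace, as a continuous linear functional. -/
noncomputable def _root_.Matrix.traceCLM (d : ℕ) : Matrix (Fin d) (Fin d) ℝ →L[ℝ] ℝ :=
  LinearMap.toContinuousLinearMap (traceLinearMap (Fin d) ℝ ℝ)

lemma integrable_trace {μ : Measure Ω} [IsFiniteMeasure μ] (hX : IsBddMeas X) :
    Integrable (fun ω => trace (X ω)) μ :=
  (traceCLM d).integrable_comp hX.integrable

lemma integral_trace {μ : Measure Ω} [IsFiniteMeasure μ] (hX : IsBddMeas X) :
    ∫ ω, trace (X ω) ∂μ = trace (∫ ω, X ω ∂μ) :=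
  (traceCLM d).integral_comp_comm hX.integrable

lemma integral_trace_mul_left {μ : Measure Ω} [IsFiniteMeasure μ] (hX : IsBddMeas X)
    (A : Matrix (Fin d) (Fin d) ℝ) :
    ∫ ω, trace (A * X ω) ∂μ = trace (A * ∫ ω, X ω ∂μ) := by
  rw [((const A).mul hX).integral_trace, integral_const_mul_of_integrable hX.integrable]

lemma integral_trace_mul_right {μ : Measure Ω} [IsFiniteMeasure μ] (hX : IsBddMeas X)
    (A : Matrix (Fin d) (Fin d) ℝ) :
    ∫ ω, trace (X ω * A) ∂μ = trace ((∫ ω, X ω ∂μ) * A) := by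
  simp only [trace_mul_comm _ A]; exact hX.integral_trace_mul_left A

lemma isSymm_integral {μ : Measure Ω} [IsFiniteMeasure μ] (hX : IsBddMeas X)
    (hs : ∀ ω, (X ω).IsSymm) : (∫ ω, X ω ∂μ).IsSymm := by
  have := (LinearMap.toContinuousLinearMap
    (transposeLinearEquiv (Fin d) (Fin d) ℝ ℝ).toLinearMap).integral_comp_comm
    (hX.integrable (μ := μ))
  have h2 : ∀ ω, (LinearMap.toContinuousLinearMap
    (transposeLinearEquiv (Fin d) (Fin d) ℝ ℝ).toLinearMap) (X ω) = X ω := fun ω => hs ω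
  simp only [h2] at this
  exact this.symm

lemma fst {Ω' : Type*} [MeasurableSpace Ω'] (hX : IsBddMeas X) :
    IsBddMeas (fun z : Ω × Ω' => X z.1) :=
  ⟨hX.measurable.comp measurable_fst, hX.bdd.imp fun _ h z => h z.1⟩

lemma snd {Ω' : Type*} [MeasurableSpace Ω'] (hX : IsBddMeas X) :
    IsBddMeas (fun z : Ω' × Ω => X z.2) :=
  ⟨hX.measurable.comp measurable_snd, hX.bdd.imp fun _ h z => h z.2⟩

variable {μ : Measure Ω} [IsProbabilityMeasure μ]

lemma integral_prod_trace_mul (hX : IsBddMeas X) (hY : IsBddMeas Y) :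
    ∫ z : Ω × Ω, trace (X z.1 * Y z.2) ∂(μ.prod μ) =
      trace ((∫ ω, X ω ∂μ) * ∫ ω, Y ω ∂μ) := by
  rw [integral_prod _ (hX.fst.mul hY.snd).integrable_trace]
  simp only [hY.integral_trace_mul_left, hX.integral_trace_mul_right]

lemma integral_prod_trace_mul' (hX : IsBddMeas X) (hY : IsBddMeas Y) :
    ∫ z : Ω × Ω, trace (X z.2 * Y z.1) ∂(μ.prod μ) =
      trace ((∫ ω, X ω ∂μ) * ∫ ω, Y ω ∂μ) := by
  simp only [trace_mul_comm (X _)]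
  rw [hY.integral_prod_trace_mul hX, trace_mul_comm]

/-- Covariance as half the mean product of the increments of two independent copies. -/
lemma integral_prod_trace_sub_mul_sub (hX : IsBddMeas X) (hY : IsBddMeas Y) :
    ∫ z : Ω × Ω, trace ((X z.1 - X z.2) * (Y z.1 - Y z.2)) ∂(μ.prod μ) =
      2 * ∫ ω, trace ((X ω - ∫ ω', X ω' ∂μ) * Y ω) ∂μ := by
  have e1 : ∀ z : Ω × Ω, trace ((X z.1 - X z.2) * (Y z.1 - Y z.2)) =
      (trace (X z.1 * Y z.1) + trace (X z.2 * Y z.2)) -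
        (trace (X z.1 * Y z.2) + trace (X z.2 * Y z.1)) := fun z => by
    simp only [Matrix.sub_mul, Matrix.mul_sub, trace_sub]; ring
  have i11 := (hX.mul hY).fst (Ω' := Ω) |>.integrable_trace (μ := μ.prod μ)
  have i22 := (hX.mul hY).snd (Ω' := Ω) |>.integrable_trace (μ := μ.prod μ)
  have i12 := (hX.fst (Ω' := Ω)).mul (hY.snd (Ω' := Ω)) |>.integrable_trace (μ := μ.prod μ)
  have i21 := (hX.snd (Ω' := Ω)).mul (hY.fst (Ω' := Ω)) |>.integrable_trace (μ := μ.prod μ)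
  simp only [e1]
  rw [integral_sub (i11.fun_add i22) (i12.fun_add i21), integral_add i11 i22, integral_add i12 i21,
    integral_fun_fst (fun ω => trace (X ω * Y ω)),
    integral_fun_snd (fun ω => trace (X ω * Y ω)),
    probReal_univ, one_smul,
    hX.integral_prod_trace_mul hY, hX.integral_prod_trace_mul' hY]
  simp only [Matrix.sub_mul, trace_sub]
  rw [integral_sub (hX.mul hY).integrable_trace ((const _).mul hY).integrable_trace,
    hY.integral_trace_mul_left]
  ring

lemma integral_prod_trace_add_mul_add (hX : IsBddMeas X) (hY : IsBddMeas Y) :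
    ∫ z : Ω × Ω, trace ((X z.1 + X z.2) * (Y z.1 + Y z.2)) ∂(μ.prod μ) =
      2 * ∫ ω, trace ((X ω + ∫ ω', X ω' ∂μ) * Y ω) ∂μ := by
  have e1 : ∀ z : Ω × Ω, trace ((X z.1 + X z.2) * (Y z.1 + Y z.2)) =
      (trace (X z.1 * Y z.1) + trace (X z.2 * Y z.2)) +
        (trace (X z.1 * Y z.2) + trace (X z.2 * Y z.1)) := fun z => by
    simp only [Matrix.add_mul, Matrix.mul_add, trace_add]; ring
  have i11 := (hX.mul hY).fst (Ω' := Ω) |>.integrable_trace (μ := μ.prod μ)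
  have i22 := (hX.mul hY).snd (Ω' := Ω) |>.integrable_trace (μ := μ.prod μ)
  have i12 := (hX.fst (Ω' := Ω)).mul (hY.snd (Ω' := Ω)) |>.integrable_trace (μ := μ.prod μ)
  have i21 := (hX.snd (Ω' := Ω)).mul (hY.fst (Ω' := Ω)) |>.integrable_trace (μ := μ.prod μ)
  simp only [e1]
  rw [integral_add (i11.fun_add i22) (i12.fun_add i21), integral_add i11 i22, integral_add i12 i21,
    integral_fun_fst (fun ω => trace (X ω * Y ω)),
    integral_fun_snd (fun ω => trace (X ω * Y ω)),
    probReal_univ, one_smul,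
    hX.integral_prod_trace_mul hY, hX.integral_prod_trace_mul' hY]
  simp only [Matrix.add_mul, trace_add]
  rw [integral_add (hX.mul hY).integrable_trace ((const _).mul hY).integrable_trace,
    hY.integral_trace_mul_left]
  ring

/-- For a centered `X`, the cross terms of `(X - X')²` vanish. -/
lemma integral_prod_trace_sub_sq_mul_add (hX : IsBddMeas X) (hY : IsBddMeas Y)
    (h0 : ∫ ω, X ω ∂μ = 0) :
    ∫ z : Ω × Ω, trace ((X z.1 - X z.2) ^ 2 * (Y z.1 + Y z.2)) ∂(μ.prod μ) =
      2 * ∫ ω, trace ((X ω ^ 2 + ∫ ω', X ω' ^ 2 ∂μ) * Y ω) ∂μ := by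
  have e1 : ∀ z : Ω × Ω, trace ((X z.1 - X z.2) ^ 2 * (Y z.1 + Y z.2)) =
      trace ((X z.1 ^ 2 + X z.2 ^ 2) * (Y z.1 + Y z.2)) -
        ((trace (Y z.1 * X z.1 * X z.2) + trace (X z.1 * Y z.1 * X z.2)) +
        (trace (X z.2 * Y z.2 * X z.1) + trace (Y z.2 * X z.2 * X z.1))) := fun z => by
    have hsq : (X z.1 - X z.2) ^ 2 =
        X z.1 ^ 2 + X z.2 ^ 2 - X z.1 * X z.2 - X z.2 * X z.1 := by noncomm_ring
    have t1 : trace (Y z.1 * X z.1 * X z.2) = trace (X z.1 * X z.2 * Y z.1) := by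
      rw [Matrix.mul_assoc, trace_mul_comm]
    have t2 : trace (X z.1 * Y z.1 * X z.2) = trace (X z.2 * X z.1 * Y z.1) := by
      rw [trace_mul_comm, Matrix.mul_assoc]
    have t3 : trace (X z.2 * Y z.2 * X z.1) = trace (X z.1 * X z.2 * Y z.2) := by
      rw [trace_mul_comm, Matrix.mul_assoc]
    have t4 : trace (Y z.2 * X z.2 * X z.1) = trace (X z.2 * X z.1 * Y z.2) := by
      rw [Matrix.mul_assoc, trace_mul_comm]
    rw [t1, t2, t3, t4, hsq]
    simp only [Matrix.add_mul, Matrix.sub_mul, Matrix.mul_add, trace_add, trace_sub]; ring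
  have hYX := hY.mul hX
  have hXY := hX.mul hY
  have i1 := ((hX.pow 2).fst (Ω' := Ω)).add ((hX.pow 2).snd (Ω' := Ω)) |>.mul
    ((hY.fst (Ω' := Ω)).add (hY.snd (Ω' := Ω))) |>.integrable_trace (μ := μ.prod μ)
  have j1 := (hYX.fst (Ω' := Ω)).mul (hX.snd (Ω' := Ω)) |>.integrable_trace (μ := μ.prod μ)
  have j2 := (hXY.fst (Ω' := Ω)).mul (hX.snd (Ω' := Ω)) |>.integrable_trace (μ := μ.prod μ)
  have j3 := (hXY.snd (Ω' := Ω)).mul (hX.fst (Ω' := Ω)) |>.integrable_trace (μ := μ.prod μ)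
  have j4 := (hYX.snd (Ω' := Ω)).mul (hX.fst (Ω' := Ω)) |>.integrable_trace (μ := μ.prod μ)
  simp only [e1]
  rw [integral_sub i1 ((j1.fun_add j2).fun_add (j3.fun_add j4)),
    integral_add (j1.fun_add j2) (j3.fun_add j4),
    integral_add j1 j2, integral_add j3 j4, hYX.integral_prod_trace_mul hX,
    hXY.integral_prod_trace_mul hX, hYX.integral_prod_trace_mul' hX,
    hXY.integral_prod_trace_mul' hX, (hX.pow 2).integral_prod_trace_add_mul_add hY, h0]
  simp

end IsBddMeas

variable {μ : Measure Ω} [IsProbabilityMeasure μ]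

lemma integrable_comp_prod {X B : Ω → Matrix (Fin d) (Fin d) ℝ} (hX : IsBddMeas X)
    (hB : IsBddMeas B)
    {Φ : Matrix (Fin d) (Fin d) ℝ × Matrix (Fin d) (Fin d) ℝ → ℝ} (hΦ : Continuous Φ) :
    Integrable (fun z : Ω × Ω => Φ (X z.1, B z.2)) (μ.prod μ) := by
  have hmm : Measurable (Prod.map X B) := hX.measurable.prodMap hB.measurable
  obtain ⟨K, hK⟩ := hX.bdd
  obtain ⟨K', hK'⟩ := hB.bdd
  have : ProperSpace (Matrix (Fin d) (Fin d) ℝ) := FiniteDimensional.proper ℝ _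
  obtain ⟨N, hN⟩ := ((isCompact_closedBall (0 : Matrix (Fin d) (Fin d) ℝ) K).prod
    (isCompact_closedBall (0 : Matrix (Fin d) (Fin d) ℝ) K')).exists_bound_of_continuousOn
    hΦ.continuousOn
  exact Integrable.of_bound (hΦ.measurable.comp hmm).aestronglyMeasurable N
    (Filter.Eventually.of_forall fun z => hN _ ⟨by simpa using hK z.1, by simpa using hK' z.2⟩)

/-- Integrating a function of two independent bounded random matrices one variable at a time. -/
lemma integral_indep {X B : Ω → Matrix (Fin d) (Fin d) ℝ} (hX : IsBddMeas X) (hB : IsBddMeas B)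
    (h : IndepFun X B μ)
    {Φ : Matrix (Fin d) (Fin d) ℝ × Matrix (Fin d) (Fin d) ℝ → ℝ} (hΦ : Continuous Φ) :
    ∫ ω, Φ (X ω, B ω) ∂μ = ∫ ω', ∫ ω, Φ (X ω, B ω') ∂μ ∂μ := by
  have hmX := hX.measurable
  have hmB := hB.measurable
  have h1 := (indepFun_iff_map_prod_eq_prod_map_map hmX.aemeasurable hmB.aemeasurable).1 h
  have h2 : ∫ ω, Φ (X ω, B ω) ∂μ = ∫ p, Φ p ∂(μ.map fun ω => (X ω, B ω)) :=
    (integral_map (hmX.prodMk hmB).aemeasurable hΦ.measurable.aestronglyMeasurable).symm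
  have hmm : Measurable (Prod.map X B) := hmX.prodMap hmB
  rw [h2, h1, Measure.map_prod_map _ _ hmX hmB,
    integral_map hmm.aemeasurable hΦ.measurable.aestronglyMeasurable]
  exact integral_prod_symm (fun z : Ω × Ω => Φ (X z.1, B z.2)) (integrable_comp_prod hX hB hΦ)

end Bounded

end Matrix

/-! ### Exchangeable pairs -/

namespace Matrix

section Exchangeable

variable {d : ℕ} {Ω : Type*} [MeasurableSpace Ω]

/-- A pair of continuous functional calculi `F = f(·)` and `H = h(·)` of symmetric matrices in
which `h ≥ 0` controls the difference quotients of `f` by its average at the two endpoints; for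
instance `h = |f'|` when this is convex. -/
structure MeanValuePair (F H : Matrix (Fin d) (Fin d) ℝ → Matrix (Fin d) (Fin d) ℝ)
    (f h : ℝ → ℝ) : Prop where
  continuous_fst : Continuous F
  continuous_snd : Continuous H
  spectral_fst : IsSpectral F f
  spectral_snd : IsSpectral H h
  abs_sub_le : ∀ s t, |f s - f t| ≤ |s - t| * ((h s + h t) / 2)
  nonneg : ∀ t, 0 ≤ h t

variable {μ : Measure Ω} [IsProbabilityMeasure μ]
  {F H : Matrix (Fin d) (Fin d) ℝ → Matrix (Fin d) (Fin d) ℝ} {f h : ℝ → ℝ}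
  {X : Ω → Matrix (Fin d) (Fin d) ℝ}

/-- The exchangeable pair bound for one summand `X`, the others being frozen in `B`. -/
lemma MeanValuePair.integral_trace_mul_le (hFH : MeanValuePair F H f h) (hX : IsBddMeas X)
    (hs : ∀ ω, (X ω).IsSymm) (h0 : ∫ ω, X ω ∂μ = 0) {B : Matrix (Fin d) (Fin d) ℝ}
    (hB : B.IsSymm) :
    ∫ ω, trace (X ω * F (B + X ω)) ∂μ ≤
      1 / 2 * ∫ ω, trace ((X ω ^ 2 + ∫ ω', X ω' ^ 2 ∂μ) * H (B + X ω)) ∂μ := by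
  have hBX := (IsBddMeas.const B).add hX
  have hF := hBX.comp hFH.continuous_fst
  have hH := hBX.comp hFH.continuous_snd
  have e1 := hX.integral_prod_trace_sub_mul_sub (μ := μ) hF
  have e2 := hX.integral_prod_trace_sub_sq_mul_add hH h0
  have hle : ∫ z : Ω × Ω, trace ((X z.1 - X z.2) * (F (B + X z.1) - F (B + X z.2))) ∂(μ.prod μ)
      ≤ ∫ z : Ω × Ω, 1 / 2 * trace ((X z.1 - X z.2) ^ 2 * (H (B + X z.1) + H (B + X z.2)))
        ∂(μ.prod μ) := by
    refine integral_mono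
      ((hX.fst.sub hX.snd).mul (hF.fst.sub hF.snd)).integrable_trace
      ((((hX.fst.sub hX.snd).pow 2).mul (hH.fst.add hH.snd)).integrable_trace.const_mul _)
      fun z => ?_
    have := hFH.spectral_fst.trace_mul_sub_le hFH.spectral_snd hFH.abs_sub_le hFH.nonneg
      (hB.add (hs z.1)) (hB.add (hs z.2)) ((hs z.1).sub (hs z.2)) one_pos
    rw [add_sub_add_left_eq_sub, inv_one, one_smul, Matrix.add_mul, trace_add] at this
    dsimp only
    linarith
  rw [integral_const_mul, e1, e2, h0] at hle
  simp only [sub_zero] at hle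
  linarith

/-- `(x² - y²)² ≤ 2 L² (x² + y²)` in the Loewner order. -/
lemma posSemidef_two_mul_sub_sq {x y : Matrix (Fin d) (Fin d) ℝ} (hx : x.IsSymm) (hy : y.IsSymm)
    {L : ℝ} (hxL : ‖x‖ ≤ L) (hyL : ‖y‖ ≤ L) :
    ((2 * L ^ 2) • (x ^ 2 + y ^ 2) - (x ^ 2 - y ^ 2) ^ 2).PosSemidef := by
  have key : ∀ z : Matrix (Fin d) (Fin d) ℝ, z.IsSymm → ‖z‖ ≤ L →
      (L ^ 2 • z ^ 2 - z ^ 4).PosSemidef := by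
    intro z hz hzL
    have h1 : ‖z ^ 2‖ ≤ L ^ 2 := by
      rw [sq, sq]
      exact (norm_mul_le _ _).trans (mul_le_mul hzL hzL (norm_nonneg _)
        ((norm_nonneg _).trans hzL))
    have h2 := ((hz.pow 2).posSemidef_smul_one_sub h1).mul_mul_conjTranspose_same z
    rw [conjTranspose_eq_transpose_of_trivial, hz.eq] at h2
    convert h2 using 1
    simp only [Matrix.mul_sub, Matrix.sub_mul, Matrix.mul_smul, Matrix.smul_mul, Matrix.mul_one]
    congr 1
    · rw [← sq z]
    · noncomm_ring
  have h1 := key x hx hxL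
  have h2 := key y hy hyL
  have h3 := ((hx.pow 2).add (hy.pow 2)).posSemidef_sq
  convert ((h1.add h1).add (h2.add h2)).add h3 using 1
  have e : (x ^ 2 - y ^ 2) ^ 2 = x ^ 4 + x ^ 4 + (y ^ 4 + y ^ 4) - (x ^ 2 + y ^ 2) ^ 2 := by
    noncomm_ring
  rw [e, two_mul, add_smul, smul_add]
  abel

/-- The exchangeable pair bound for the centered square of one summand. The excess of `X²` over its
mean is paid for by the factor `L`. -/
lemma MeanValuePair.integral_trace_sq_sub_mul_le (hFH : MeanValuePair F H f h) (hX : IsBddMeas X)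
    (hs : ∀ ω, (X ω).IsSymm) (h0 : ∫ ω, X ω ∂μ = 0) {L : ℝ} (hL : 0 < L) (hXL : ∀ ω, ‖X ω‖ ≤ L)
    {B : Matrix (Fin d) (Fin d) ℝ} (hB : B.IsSymm) :
    ∫ ω, trace ((X ω ^ 2 - ∫ ω', X ω' ^ 2 ∂μ) * F (B + X ω)) ∂μ ≤
      L / √2 * ∫ ω, trace ((X ω ^ 2 + ∫ ω', X ω' ^ 2 ∂μ) * H (B + X ω)) ∂μ := by
  have hBX := (IsBddMeas.const B).add hX
  have hF := hBX.comp hFH.continuous_fst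
  have hH := hBX.comp hFH.continuous_snd
  have hX2 := hX.pow 2
  have e1 := hX2.integral_prod_trace_sub_mul_sub (μ := μ) hF
  have e2 := hX.integral_prod_trace_sub_sq_mul_add hH h0
  have e3 := hX2.integral_prod_trace_add_mul_add (μ := μ) hH
  -- the weight that balances the two terms of the mean value inequality
  set a : ℝ := (√2 * L)⁻¹ with ha
  have h2 : √2 * √2 = 2 := Real.mul_self_sqrt (by norm_num)
  have ha0 : 0 < a := by positivity
  have i2 := (((hX.fst (Ω' := Ω)).sub (hX.snd (Ω' := Ω))).pow 2).mul
    (hH.fst.add hH.snd) |>.integrable_trace (μ := μ.prod μ)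
  have i3 := ((hX2.fst (Ω' := Ω)).add (hX2.snd (Ω' := Ω))).mul
    (hH.fst.add hH.snd) |>.integrable_trace (μ := μ.prod μ)
  have hle : ∫ z : Ω × Ω, trace ((X z.1 ^ 2 - X z.2 ^ 2) * (F (B + X z.1) - F (B + X z.2)))
        ∂(μ.prod μ)
      ≤ ∫ z : Ω × Ω, (a * L ^ 2 / 2 * trace ((X z.1 ^ 2 + X z.2 ^ 2) *
            (H (B + X z.1) + H (B + X z.2))) +
          a⁻¹ / 4 * trace ((X z.1 - X z.2) ^ 2 * (H (B + X z.1) + H (B + X z.2))))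
        ∂(μ.prod μ) := by
    refine integral_mono
      ((hX2.fst.sub hX2.snd).mul (hF.fst.sub hF.snd)).integrable_trace
      ((i3.const_mul _).fun_add (i2.const_mul _)) fun z => ?_
    have m1 := hFH.spectral_fst.trace_mul_sub_le hFH.spectral_snd hFH.abs_sub_le hFH.nonneg
      (hB.add (hs z.1)) (hB.add (hs z.2)) (((hs z.1).pow 2).sub ((hs z.2).pow 2)) ha0
    have hP := (hFH.spectral_snd.posSemidef hFH.nonneg (hB.add (hs z.1))).add
      (hFH.spectral_snd.posSemidef hFH.nonneg (hB.add (hs z.2)))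
    have m2 := trace_mul_le_trace_mul (posSemidef_two_mul_sub_sq (hs z.1) (hs z.2) (hXL z.1)
      (hXL z.2)) hP
    rw [add_sub_add_left_eq_sub, Matrix.add_mul, trace_add, Matrix.smul_mul, Matrix.smul_mul,
      trace_smul, trace_smul, smul_eq_mul, smul_eq_mul] at m1
    rw [Matrix.smul_mul, trace_smul, smul_eq_mul] at m2
    have m3 := mul_le_mul_of_nonneg_left m2 ha0.le
    dsimp only
    linarith
  rw [integral_add (i3.const_mul _) (i2.const_mul _), integral_const_mul, integral_const_mul, e1,
    e2, e3] at hle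
  have hc : a * L ^ 2 / 2 + a⁻¹ / 4 = L / √2 := by
    rw [ha, inv_inv]
    field_simp
    nlinarith
  set J := ∫ ω, trace ((X ω ^ 2 + ∫ ω', X ω' ^ 2 ∂μ) * H (B + X ω)) ∂μ
  have : a * L ^ 2 / 2 * (2 * J) + a⁻¹ / 4 * (2 * J) = 2 * (L / √2 * J) := by rw [← hc]; ring
  linarith

/-- Independence reduces an inequality between means to the case of a frozen second argument. -/
lemma integral_le_of_indep {B : Ω → Matrix (Fin d) (Fin d) ℝ} (hX : IsBddMeas X)
    (hB : IsBddMeas B) (hi : IndepFun X B μ)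
    {Φ Ψ : Matrix (Fin d) (Fin d) ℝ × Matrix (Fin d) (Fin d) ℝ → ℝ} (hΦ : Continuous Φ)
    (hΨ : Continuous Ψ)
    (hle : ∀ ω', ∫ ω, Φ (X ω, B ω') ∂μ ≤ ∫ ω, Ψ (X ω, B ω') ∂μ) :
    ∫ ω, Φ (X ω, B ω) ∂μ ≤ ∫ ω, Ψ (X ω, B ω) ∂μ := by
  rw [integral_indep hX hB hi hΦ, integral_indep hX hB hi hΨ]
  have key : ∀ {Φ : Matrix (Fin d) (Fin d) ℝ × Matrix (Fin d) (Fin d) ℝ → ℝ}, Continuous Φ →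
      Integrable (fun ω' => ∫ ω, Φ (X ω, B ω') ∂μ) μ := by
    intro Φ hΦ
    exact (integrable_comp_prod hX hB hΦ).integral_prod_right
  exact integral_mono (key hΦ) (key hΨ) hle

end Exchangeable
end Matrix

/-! ### Sums of independent centered matrices -/

namespace Matrix

section Sums

variable {d m : ℕ} {Ω : Type*} [MeasurableSpace Ω]

/-- A finite family of independent centered random symmetric matrices, all bounded in spectral norm
by `L` everywhere. -/
structure IsCenteredFamily (X : Fin m → Ω → Matrix (Fin d) (Fin d) ℝ) (μ : Measure Ω) (L : ℝ) :
    Prop where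
  measurable : ∀ k, Measurable (X k)
  isSymm : ∀ k ω, (X k ω).IsSymm
  norm_le : ∀ k ω, ‖X k ω‖ ≤ L
  integral_eq_zero : ∀ k, ∫ ω, X k ω ∂μ = 0
  indep : iIndepFun X μ

/-- The matrix variance `∑ E Xₖ²`. -/
noncomputable def sumVar (X : Fin m → Ω → Matrix (Fin d) (Fin d) ℝ) (μ : Measure Ω) :
    Matrix (Fin d) (Fin d) ℝ :=
  ∑ k, ∫ ω, X k ω ^ 2 ∂μ

namespace IsCenteredFamily

variable {X : Fin m → Ω → Matrix (Fin d) (Fin d) ℝ} {μ : Measure Ω}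
  {L : ℝ} {F H : Matrix (Fin d) (Fin d) ℝ → Matrix (Fin d) (Fin d) ℝ} {f h : ℝ → ℝ}

lemma isBddMeas (hX : IsCenteredFamily X μ L) (k : Fin m) : IsBddMeas (X k) :=
  ⟨hX.measurable k, L, hX.norm_le k⟩

lemma isBddMeas_sum (hX : IsCenteredFamily X μ L) (s : Finset (Fin m)) :
    IsBddMeas (fun ω => ∑ k ∈ s, X k ω) :=
  IsBddMeas.sum s hX.isBddMeas

lemma isSymm_finsetSum {A : Fin m → Matrix (Fin d) (Fin d) ℝ} (s : Finset (Fin m))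
    (hA : ∀ k, (A k).IsSymm) : (∑ k ∈ s, A k).IsSymm := by
  rw [IsSymm, transpose_sum]
  exact Finset.sum_congr rfl fun k _ => hA k

lemma indepFun_erase (hX : IsCenteredFamily X μ L) (k : Fin m) :
    IndepFun (X k) (fun ω => ∑ j ∈ Finset.univ.erase k, X j ω) μ := by
  have := (hX.indep.indepFun_finsetSum_of_notMem hX.measurable
    (Finset.notMem_erase k Finset.univ)).symm
  convert this using 1
  ext1 ω
  rw [Finset.sum_apply]

lemma continuous_trace_comp {Z : Type*} [TopologicalSpace Z] {G : Z → Matrix (Fin d) (Fin d) ℝ}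
    (hG : Continuous G) : Continuous (fun z => trace (G z)) :=
  (traceCLM d).continuous.comp hG

variable [IsProbabilityMeasure μ]

lemma integral_sum_eq_zero (hX : IsCenteredFamily X μ L) (s : Finset (Fin m)) :
    ∫ ω, ∑ k ∈ s, X k ω ∂μ = 0 := by
  rw [integral_finsetSum _ fun k _ => (hX.isBddMeas k).integrable]
  exact Finset.sum_eq_zero fun k _ => hX.integral_eq_zero k

lemma integral_trace_sum_mul (hX : IsCenteredFamily X μ L) (hH : Continuous H) :
    ∑ k, ∫ ω, trace ((X k ω ^ 2 + ∫ ω', X k ω' ^ 2 ∂μ) * H (∑ j, X j ω)) ∂μ =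
      ∫ ω, trace ((∑ k, X k ω ^ 2 + sumVar X μ) * H (∑ j, X j ω)) ∂μ := by
  rw [← integral_finsetSum]
  · refine integral_congr_ae (Filter.Eventually.of_forall fun ω => ?_)
    dsimp only
    rw [← trace_sum, ← Finset.sum_mul, Finset.sum_add_distrib, sumVar]
  · exact fun k _ => ((((hX.isBddMeas k).pow 2).add (.const _)).mul
      ((hX.isBddMeas_sum _).comp hH)).integrable_trace

/-- `E tr (S F(S)) ≤ E tr ((Q + V) H(S)) / 2`, where `S = ∑ Xₖ`, `Q = ∑ Xₖ²` and `V = E Q`. -/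
theorem integral_trace_mul_le (hX : IsCenteredFamily X μ L) (hFH : MeanValuePair F H f h) :
    ∫ ω, trace ((∑ k, X k ω) * F (∑ k, X k ω)) ∂μ ≤
      1 / 2 * ∫ ω, trace ((∑ k, X k ω ^ 2 + sumVar X μ) * H (∑ k, X k ω)) ∂μ := by
  have hFc := hFH.continuous_fst
  have hHc := hFH.continuous_snd
  have e1 : ∫ ω, trace ((∑ k, X k ω) * F (∑ k, X k ω)) ∂μ =
      ∑ k, ∫ ω, trace (X k ω * F (∑ j, X j ω)) ∂μ := by
    rw [← integral_finsetSum]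
    · exact integral_congr_ae (Filter.Eventually.of_forall fun ω => by
        dsimp only; rw [← trace_sum, ← Finset.sum_mul])
    · exact fun k _ => ((hX.isBddMeas k).mul ((hX.isBddMeas_sum _).comp hFc)).integrable_trace
  rw [e1, ← hX.integral_trace_sum_mul hHc, Finset.mul_sum]
  refine Finset.sum_le_sum fun k _ => ?_
  have := integral_le_of_indep (hX.isBddMeas k) (hX.isBddMeas_sum (Finset.univ.erase k))
    (hX.indepFun_erase k)
    (Φ := fun p => trace (p.1 * F (p.2 + p.1)))
    (Ψ := fun p => 1 / 2 * trace ((p.1 ^ 2 + ∫ ω', X k ω' ^ 2 ∂μ) * H (p.2 + p.1)))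
    (continuous_trace_comp (by fun_prop))
    (continuous_const.mul (continuous_trace_comp (by fun_prop)))
    (fun ω' => by
      simp only [integral_const_mul]
      exact hFH.integral_trace_mul_le (hX.isBddMeas k) (hX.isSymm k) (hX.integral_eq_zero k)
        (isSymm_finsetSum _ fun j => hX.isSymm j ω'))
  simpa only [integral_const_mul, Finset.sum_erase_add _ _ (Finset.mem_univ k)] using this

/-- `E tr ((Q - V) F(S)) ≤ (L / √2) E tr ((Q + V) H(S))`, where `S = ∑ Xₖ`, `Q = ∑ Xₖ²` and
`V = E Q`. -/
theorem integral_trace_sq_sub_mul_le (hX : IsCenteredFamily X μ L) (hFH : MeanValuePair F H f h)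
    (hL : 0 < L) :
    ∫ ω, trace ((∑ k, X k ω ^ 2) * F (∑ k, X k ω)) ∂μ -
        ∫ ω, trace (sumVar X μ * F (∑ k, X k ω)) ∂μ ≤
      L / √2 * ∫ ω, trace ((∑ k, X k ω ^ 2 + sumVar X μ) * H (∑ k, X k ω)) ∂μ := by
  have hFc := hFH.continuous_fst
  have hHc := hFH.continuous_snd
  have hFS := (hX.isBddMeas_sum Finset.univ).comp hFc
  have e1 : ∫ ω, trace ((∑ k, X k ω ^ 2) * F (∑ k, X k ω)) ∂μ -
        ∫ ω, trace (sumVar X μ * F (∑ k, X k ω)) ∂μ =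
      ∑ k, ∫ ω, trace ((X k ω ^ 2 - ∫ ω', X k ω' ^ 2 ∂μ) * F (∑ j, X j ω)) ∂μ := by
    rw [← integral_finsetSum, ← integral_sub]
    · refine integral_congr_ae (Filter.Eventually.of_forall fun ω => ?_)
      dsimp only
      rw [← trace_sum, ← Finset.sum_mul, Finset.sum_sub_distrib, sumVar, Matrix.sub_mul, trace_sub]
    · exact ((IsBddMeas.sum _ fun k => (hX.isBddMeas k).pow 2).mul hFS).integrable_trace
    · exact ((IsBddMeas.const _).mul hFS).integrable_trace
    · exact fun k _ => ((((hX.isBddMeas k).pow 2).sub (.const _)).mul hFS).integrable_trace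
  rw [e1, ← hX.integral_trace_sum_mul hHc, Finset.mul_sum]
  refine Finset.sum_le_sum fun k _ => ?_
  have := integral_le_of_indep (hX.isBddMeas k) (hX.isBddMeas_sum (Finset.univ.erase k))
    (hX.indepFun_erase k)
    (Φ := fun p => trace ((p.1 ^ 2 - ∫ ω', X k ω' ^ 2 ∂μ) * F (p.2 + p.1)))
    (Ψ := fun p => L / √2 * trace ((p.1 ^ 2 + ∫ ω', X k ω' ^ 2 ∂μ) * H (p.2 + p.1)))
    (continuous_trace_comp (by fun_prop))
    (continuous_const.mul (continuous_trace_comp (by fun_prop)))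
    (fun ω' => by
      simp only [integral_const_mul]
      exact hFH.integral_trace_sq_sub_mul_le (hX.isBddMeas k) (hX.isSymm k)
        (hX.integral_eq_zero k) hL (hX.norm_le k) (isSymm_finsetSum _ fun j => hX.isSymm j ω'))
  simpa only [integral_const_mul, Finset.sum_erase_add _ _ (Finset.mem_univ k)] using this

end IsCenteredFamily

end Sums
end Matrix

/-! ### Trace moments of order two and four -/

namespace Matrix

section Pairs

variable {d : ℕ}

lemma meanValuePair_id :
    MeanValuePair (d := d) (fun A => A) (fun _ => 1) (fun t => t) (fun _ => 1) where
  continuous_fst := continuous_id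
  continuous_snd := continuous_const
  spectral_fst := by simpa using isSpectral_pow (n := Fin d) 1
  spectral_snd := by simpa using isSpectral_pow (n := Fin d) 0
  abs_sub_le s t := by norm_num
  nonneg t := zero_le_one

lemma meanValuePair_cube :
    MeanValuePair (d := d) (fun A => A ^ 3) (fun A => (3 : ℝ) • A ^ 2) (fun t => t ^ 3)
      (fun t => 3 * t ^ 2) where
  continuous_fst := continuous_pow 3
  continuous_snd := by fun_prop
  spectral_fst := isSpectral_pow 3
  spectral_snd := (isSpectral_pow 2).const_smul 3
  abs_sub_le s t := by
    rw [show s ^ 3 - t ^ 3 = (s - t) * (s ^ 2 + s * t + t ^ 2) by ring, abs_mul]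
    refine mul_le_mul_of_nonneg_left ?_ (abs_nonneg _)
    rw [abs_le]
    constructor <;> nlinarith [sq_nonneg (s - t), sq_nonneg (s + t), sq_nonneg s, sq_nonneg t]
  nonneg t := by positivity

/-- The logarithmic mean of `eᵃ` and `eᵇ` is at most their arithmetic mean. -/
lemma abs_exp_sub_exp_le (a b : ℝ) :
    |Real.exp a - Real.exp b| ≤ |a - b| * ((Real.exp a + Real.exp b) / 2) := by
  have key : ∀ x : ℝ, 0 ≤ x → Real.exp x - 1 ≤ x * ((Real.exp x + 1) / 2) := by
    intro x hx
    have hd : ∀ y : ℝ, HasDerivAt (fun y => y * ((Real.exp y + 1) / 2) - (Real.exp y - 1))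
        (1 * ((Real.exp y + 1) / 2) + y * (Real.exp y / 2) - Real.exp y) y := fun y =>
      ((hasDerivAt_id y).mul (((Real.hasDerivAt_exp y).add_const 1).div_const 2)).sub
        ((Real.hasDerivAt_exp y).sub_const 1)
    have hmono : Monotone (fun y : ℝ => y * ((Real.exp y + 1) / 2) - (Real.exp y - 1)) := by
      refine monotone_of_deriv_nonneg (fun y => (hd y).differentiableAt) fun y => ?_
      rw [(hd y).deriv]
      have h1 := mul_le_mul_of_nonneg_right (Real.add_one_le_exp (-y)) (Real.exp_pos y).le
      rw [← Real.exp_add, neg_add_cancel, Real.exp_zero] at h1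
      linarith
    have := hmono hx
    simp only [Real.exp_zero] at this
    linarith
  have key2 : ∀ a b : ℝ, b ≤ a →
      |Real.exp a - Real.exp b| ≤ |a - b| * ((Real.exp a + Real.exp b) / 2) := by
    intro a b hab
    rw [abs_of_nonneg (sub_nonneg.2 hab), abs_of_nonneg (sub_nonneg.2 (Real.exp_le_exp.2 hab))]
    have h1 := mul_le_mul_of_nonneg_left (key (a - b) (sub_nonneg.2 hab)) (Real.exp_pos b).le
    have h2 : Real.exp b * Real.exp (a - b) = Real.exp a := by rw [← Real.exp_add]; ring_nf
    nlinarith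
  rcases le_total b a with h | h
  · exact key2 a b h
  · rw [abs_sub_comm, abs_sub_comm a, add_comm]; exact key2 b a h

lemma continuous_exp_matrix :
    Continuous (NormedSpace.exp : Matrix (Fin d) (Fin d) ℝ → Matrix (Fin d) (Fin d) ℝ) := by
  let _ : NormedAlgebra ℚ (Matrix (Fin d) (Fin d) ℝ) := NormedAlgebra.restrictScalars ℚ ℝ _
  exact NormedSpace.exp_continuous

lemma meanValuePair_exp {θ : ℝ} (hθ : 0 ≤ θ) :
    MeanValuePair (d := d) (fun A => NormedSpace.exp (θ • A))
      (fun A => θ • NormedSpace.exp (θ • A)) (fun t => Real.exp (θ * t))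
      (fun t => θ * Real.exp (θ * t)) where
  continuous_fst := continuous_exp_matrix.comp (continuous_const_smul θ)
  continuous_snd := (continuous_exp_matrix.comp (continuous_const_smul θ)).const_smul θ
  spectral_fst := isSpectral_exp θ
  spectral_snd := (isSpectral_exp θ).const_smul θ
  abs_sub_le s t := by
    have := abs_exp_sub_exp_le (θ * s) (θ * t)
    rw [← mul_sub, abs_mul, abs_of_nonneg hθ] at this
    calc _ ≤ _ := this
      _ = _ := by ring
  nonneg t := by positivity

end Pairs

section Moments

variable {d m : ℕ} {Ω : Type*} [MeasurableSpace Ω]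
  {X : Fin m → Ω → Matrix (Fin d) (Fin d) ℝ} {μ : Measure Ω} {L v : ℝ}

namespace IsCenteredFamily

lemma isSymm_sum (hX : IsCenteredFamily X μ L) (ω : Ω) : (∑ k, X k ω).IsSymm :=
  isSymm_finsetSum _ fun k => hX.isSymm k ω

lemma trace_sumVar_le (hv : (v • (1 : Matrix (Fin d) (Fin d) ℝ) - sumVar X μ).PosSemidef) :
    trace (sumVar X μ) ≤ d * v := by
  have := hv.trace_nonneg
  simp only [trace_sub, trace_smul, trace_one, Fintype.card_fin, smul_eq_mul] at this
  linarith

lemma trace_pow_four_le {A : Matrix (Fin d) (Fin d) ℝ} (hA : A.IsSymm) (hAL : ‖A‖ ≤ L) :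
    trace (A ^ 4) ≤ L ^ 2 * trace (A ^ 2) := by
  have h1 : ‖A ^ 2‖ ≤ L ^ 2 := by
    rw [sq, sq]
    exact (norm_mul_le _ _).trans (mul_le_mul hAL hAL (norm_nonneg _) ((norm_nonneg _).trans hAL))
  have := (hA.pow 2).trace_mul_le h1 hA.posSemidef_sq
  rwa [← pow_add] at this

lemma isBddMeas_sumSq (hX : IsCenteredFamily X μ L) : IsBddMeas (fun ω => ∑ k, X k ω ^ 2) :=
  IsBddMeas.sum _ fun k => (hX.isBddMeas k).pow 2

variable [IsProbabilityMeasure μ]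

lemma integral_sumSq (hX : IsCenteredFamily X μ L) :
    ∫ ω, ∑ k, X k ω ^ 2 ∂μ = sumVar X μ :=
  integral_finsetSum _ fun k _ => ((hX.isBddMeas k).pow 2).integrable

lemma integral_trace_sq_le (hX : IsCenteredFamily X μ L) :
    ∫ ω, trace ((∑ k, X k ω) ^ 2) ∂μ ≤ trace (sumVar X μ) := by
  have := hX.integral_trace_mul_le meanValuePair_id
  simp only [Matrix.mul_one, ← sq, trace_add] at this
  rw [integral_add hX.isBddMeas_sumSq.integrable_trace (integrable_const _),
    hX.isBddMeas_sumSq.integral_trace, hX.integral_sumSq] at this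
  simp only [integral_const, probReal_univ, one_smul] at this
  linarith

/-- The excess of `∑ Xₖ²` over its mean, against `S²`, is a genuine fourth order term: the part of
`S` independent of `Xₖ` is centered and drops out. -/
lemma integral_trace_sumSq_mul_sq_le (hX : IsCenteredFamily X μ L) :
    ∫ ω, trace ((∑ k, X k ω ^ 2) * (∑ k, X k ω) ^ 2) ∂μ -
        ∫ ω, trace (sumVar X μ * (∑ k, X k ω) ^ 2) ∂μ ≤ L ^ 2 * trace (sumVar X μ) := by
  have hS2 := (hX.isBddMeas_sum Finset.univ).pow 2
  have e1 : ∫ ω, trace ((∑ k, X k ω ^ 2) * (∑ k, X k ω) ^ 2) ∂μ -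
        ∫ ω, trace (sumVar X μ * (∑ k, X k ω) ^ 2) ∂μ =
      ∑ k, ∫ ω, trace ((X k ω ^ 2 - ∫ ω', X k ω' ^ 2 ∂μ) * (∑ j, X j ω) ^ 2) ∂μ := by
    rw [← integral_finsetSum, ← integral_sub]
    · refine integral_congr_ae (Filter.Eventually.of_forall fun ω => ?_)
      dsimp only
      rw [← trace_sum, ← Finset.sum_mul, Finset.sum_sub_distrib, sumVar, Matrix.sub_mul, trace_sub]
    · exact (hX.isBddMeas_sumSq.mul hS2).integrable_trace
    · exact ((IsBddMeas.const _).mul hS2).integrable_trace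
    · exact fun k _ => ((((hX.isBddMeas k).pow 2).sub (.const _)).mul hS2).integrable_trace
  rw [e1, sumVar, trace_sum, Finset.mul_sum]
  refine Finset.sum_le_sum fun k _ => ?_
  have hk := hX.isBddMeas k
  have hB := hX.isBddMeas_sum (Finset.univ.erase k)
  set V := ∫ ω', X k ω' ^ 2 ∂μ with hV
  have hVs : V.IsSymm := (hk.pow 2).isSymm_integral fun ω => (hX.isSymm k ω).pow 2
  have hcross : ∫ ω, trace (X k ω ^ 3 * ∑ j ∈ Finset.univ.erase k, X j ω) ∂μ = 0 := by
    rw [integral_indep hk hB (hX.indepFun_erase k) (Φ := fun p => trace (p.1 ^ 3 * p.2))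
      (continuous_trace_comp (by fun_prop))]
    simp only [(hk.pow 3).integral_trace_mul_right]
    rw [hB.integral_trace_mul_left, hX.integral_sum_eq_zero]
    simp
  have hle := integral_le_of_indep hk hB (hX.indepFun_erase k)
    (Φ := fun p => trace ((p.1 ^ 2 - V) * (p.2 + p.1) ^ 2))
    (Ψ := fun p => L ^ 2 * trace (p.1 ^ 2) + 2 * trace (p.1 ^ 3 * p.2))
    (continuous_trace_comp (by fun_prop))
    ((continuous_const.mul (continuous_trace_comp (by fun_prop))).add
      (continuous_const.mul (continuous_trace_comp (by fun_prop))))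
    (fun ω' => by
      set b := ∑ j ∈ Finset.univ.erase k, X j ω'
      have i4 := (hk.pow 4).integrable_trace (μ := μ)
      have i2 := (hk.pow 2).integrable_trace (μ := μ)
      have i3 := ((hk.pow 3).mul (.const b)).integrable_trace (μ := μ)
      have c1 := ((hk.pow 2).mul (.const (b ^ 2))).integrable_trace (μ := μ)
      have c2 := ((IsBddMeas.const (b * V + V * b)).mul hk).integrable_trace (μ := μ)
      have c3 := ((IsBddMeas.const V).mul (hk.pow 2)).integrable_trace (μ := μ)
      have c4 : Integrable (fun ω => trace (X k ω ^ 2 * b ^ 2) - trace (V * b ^ 2)) μ :=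
        c1.sub (integrable_const _)
      have c5 : Integrable (fun ω => trace (X k ω ^ 2 * b ^ 2) - trace (V * b ^ 2) -
          (trace ((b * V + V * b) * X k ω) + trace (V * X k ω ^ 2))) μ := c4.sub (c2.add c3)
      have ex : ∀ ω, trace ((X k ω ^ 2 - V) * (b + X k ω) ^ 2) =
          trace (X k ω ^ 4) + 2 * trace (X k ω ^ 3 * b) +
            ((trace (X k ω ^ 2 * b ^ 2) - trace (V * b ^ 2)) -
              (trace ((b * V + V * b) * X k ω) + trace (V * X k ω ^ 2))) := by
        intro ω
        set x := X k ω
        have h1 : (x ^ 2 - V) * (b + x) ^ 2 = x ^ 4 + x ^ 2 * b * x + x ^ 3 * b + x ^ 2 * b ^ 2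
            - V * b ^ 2 - V * b * x - V * x * b - V * x ^ 2 := by noncomm_ring
        have h2 : trace (x ^ 2 * b * x) = trace (x ^ 3 * b) := by
          rw [trace_mul_comm, ← Matrix.mul_assoc, ← pow_succ']
        have h3 : trace (V * x * b) = trace (b * V * x) := by
          rw [trace_mul_comm, Matrix.mul_assoc]
        rw [h1]
        simp only [trace_add, trace_sub, h2, h3, Matrix.add_mul]
        ring
      have hV2 : 0 ≤ trace (V * V) := by
        have := hVs.posSemidef_sq.trace_nonneg; rwa [sq] at this
      have hx4 : ∫ ω, trace (X k ω ^ 4) ∂μ ≤ ∫ ω, L ^ 2 * trace (X k ω ^ 2) ∂μ :=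
        integral_mono i4 (i2.const_mul _) fun ω =>
          trace_pow_four_le (hX.isSymm k ω) (hX.norm_le k ω)
      simp only [ex]
      rw [integral_add (i4.fun_add (i3.const_mul 2)) c5,
        integral_add i4 (i3.const_mul 2), integral_sub c4 (c2.fun_add c3),
        integral_sub c1 (integrable_const _), integral_add c2 c3,
        integral_add (i2.const_mul _) (i3.const_mul 2),
        (hk.pow 2).integral_trace_mul_right, hk.integral_trace_mul_left,
        (hk.pow 2).integral_trace_mul_left, hX.integral_eq_zero k, ← hV]
      simp only [integral_const, probReal_univ, one_smul, Matrix.mul_zero, trace_zero]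
      linarith)
  simp only [Finset.sum_erase_add _ _ (Finset.mem_univ k)] at hle
  rw [integral_add ((hk.pow 2).integrable_trace.const_mul _)
    (((hk.pow 3).mul hB).integrable_trace.const_mul 2), integral_const_mul, integral_const_mul,
    hcross, (hk.pow 2).integral_trace, ← hV] at hle
  linarith

lemma integral_trace_sumVar_mul_le
    (hv : (v • (1 : Matrix (Fin d) (Fin d) ℝ) - sumVar X μ).PosSemidef)
    {G : Ω → Matrix (Fin d) (Fin d) ℝ} (hG : IsBddMeas G) (hGP : ∀ ω, (G ω).PosSemidef) :
    ∫ ω, trace (sumVar X μ * G ω) ∂μ ≤ v * ∫ ω, trace (G ω) ∂μ := by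
  rw [← integral_const_mul]
  refine integral_mono ((IsBddMeas.const _).mul hG).integrable_trace
    (hG.integrable_trace.const_mul _) fun ω => ?_
  have := trace_mul_le_trace_mul hv (hGP ω)
  simpa [trace_smul] using this

/-- The term `3 d v²` is the Gaussian one; the other stems from the fourth moments of the single
summands. -/
theorem integral_trace_pow_four_le (hX : IsCenteredFamily X μ L) (hv0 : 0 ≤ v)
    (hv : (v • (1 : Matrix (Fin d) (Fin d) ℝ) - sumVar X μ).PosSemidef) :
    ∫ ω, trace ((∑ k, X k ω) ^ 4) ∂μ ≤ 3 * d * v ^ 2 + 3 / 2 * d * L ^ 2 * v := by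
  have hS2 := (hX.isBddMeas_sum Finset.univ).pow 2
  have h1 := hX.integral_trace_mul_le meanValuePair_cube
  have e : ∀ ω, (∑ k, X k ω ^ 2 + sumVar X μ) * (3 : ℝ) • (∑ k, X k ω) ^ 2 =
      (3 : ℝ) • ((∑ k, X k ω ^ 2) * (∑ k, X k ω) ^ 2 + sumVar X μ * (∑ k, X k ω) ^ 2) := by
    intro ω; rw [Matrix.mul_smul, Matrix.add_mul]
  simp only [← pow_succ', e, trace_smul, smul_eq_mul, trace_add] at h1
  rw [integral_const_mul, integral_add (hX.isBddMeas_sumSq.mul hS2).integrable_trace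
    ((IsBddMeas.const _).mul hS2).integrable_trace] at h1
  have h2 := hX.integral_trace_sumSq_mul_sq_le
  have h3 := integral_trace_sumVar_mul_le hv hS2 fun ω => (hX.isSymm_sum ω).posSemidef_sq
  have h4 := hX.integral_trace_sq_le
  have h5 := trace_sumVar_le hv
  have h6 : v * ∫ ω, trace ((∑ k, X k ω) ^ 2) ∂μ ≤ v * (d * v) := by gcongr; linarith
  have h7 : L ^ 2 * trace (sumVar X μ) ≤ L ^ 2 * (d * v) := by gcongr
  norm_num at h1 ⊢
  nlinarith

end IsCenteredFamily

end Moments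
end Matrix

/-! ### Exponential trace moments -/

namespace Matrix

section ExponentialMoments

variable {d m : ℕ} {Ω : Type*} [MeasurableSpace Ω]
  {X : Fin m → Ω → Matrix (Fin d) (Fin d) ℝ} {μ : Measure Ω} {L v : ℝ}

lemma IsCenteredFamily.neg (hX : IsCenteredFamily X μ L) :
    IsCenteredFamily (fun k ω => -X k ω) μ L where
  measurable k := (hX.measurable k).neg
  isSymm k ω := (hX.isSymm k ω).neg
  norm_le k ω := by rw [norm_neg]; exact hX.norm_le k ω
  integral_eq_zero k := by rw [integral_neg, hX.integral_eq_zero k, neg_zero]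
  indep := hX.indep.comp (fun _ A => -A) fun _ => measurable_neg

variable [IsProbabilityMeasure μ]

/-- Differentiation of the trace exponential moment under the integral sign. -/
lemma hasDerivAt_integral_trace_exp {S : Ω → Matrix (Fin d) (Fin d) ℝ} (hS : IsBddMeas S)
    (θ : ℝ) :
    HasDerivAt (fun t => ∫ ω, trace (NormedSpace.exp (t • S ω)) ∂μ)
      (∫ ω, trace (S ω * NormedSpace.exp (θ • S ω)) ∂μ) θ := by
  obtain ⟨K, hK⟩ := hS.bdd
  have hexp : Continuous (NormedSpace.exp : Matrix (Fin d) (Fin d) ℝ → _) := continuous_exp_matrix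
  have hc : ∀ t : ℝ, IsBddMeas (fun ω => NormedSpace.exp (t • S ω)) := fun t =>
    hS.comp (F := fun A => NormedSpace.exp (t • A)) (hexp.comp (continuous_const_smul t))
  have : ProperSpace (Matrix (Fin d) (Fin d) ℝ) := FiniteDimensional.proper ℝ _
  obtain ⟨N, hN⟩ := ((isCompact_closedBall θ 1).prod
    (isCompact_closedBall (0 : Matrix (Fin d) (Fin d) ℝ) K)).exists_bound_of_continuousOn
    (f := fun p : ℝ × Matrix (Fin d) (Fin d) ℝ => trace (p.2 * NormedSpace.exp (p.1 • p.2)))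
    (IsCenteredFamily.continuous_trace_comp (by fun_prop)).continuousOn
  refine (hasDerivAt_integral_of_dominated_loc_of_deriv_le
    (F' := fun t ω => trace (S ω * NormedSpace.exp (t • S ω))) (bound := fun _ => N)
    (Metric.closedBall_mem_nhds θ one_pos) ?_ (hc θ).integrable_trace
    (hS.mul (hc θ)).integrable_trace.aestronglyMeasurable ?_ (integrable_const _) ?_).2
  · exact Filter.Eventually.of_forall fun t => (hc t).integrable_trace.aestronglyMeasurable
  · exact Filter.Eventually.of_forall fun ω t ht => hN (t, S ω) ⟨ht, by simpa using hK ω⟩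
  · refine Filter.Eventually.of_forall fun ω t _ => ?_
    have := (traceCLM d).hasFDerivAt.comp_hasDerivAt t (hasDerivAt_exp_smul_const (S ω) t)
    have h2 : (traceCLM d) (NormedSpace.exp (t • S ω) * S ω) =
        trace (S ω * NormedSpace.exp (t • S ω)) :=
      trace_mul_comm (NormedSpace.exp (t • S ω)) (S ω)
    rw [h2] at this
    exact this

namespace IsCenteredFamily

/-- The differential inequality `m'(θ) ≤ θ v / (1 - θ L / √2) m(θ)` for the trace exponential
moment `m(θ) = E tr exp(θ S)`. -/
lemma integral_trace_mul_exp_le (hX : IsCenteredFamily X μ L) (hL : 0 < L)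
    (hv : (v • (1 : Matrix (Fin d) (Fin d) ℝ) - sumVar X μ).PosSemidef) {θ : ℝ} (hθ : 0 ≤ θ)
    (hθL : L / √2 * θ < 1) :
    ∫ ω, trace ((∑ k, X k ω) * NormedSpace.exp (θ • ∑ k, X k ω)) ∂μ ≤
      v * θ / (1 - L / √2 * θ) * ∫ ω, trace (NormedSpace.exp (θ • ∑ k, X k ω)) ∂μ := by
  have hp := meanValuePair_exp (d := d) hθ
  have hE := (hX.isBddMeas_sum Finset.univ).comp hp.continuous_fst
  have h1 := hX.integral_trace_mul_le hp
  have h2 := hX.integral_trace_sq_sub_mul_le hp hL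
  have h3 := integral_trace_sumVar_mul_le hv hE fun ω =>
    hp.spectral_fst.posSemidef (fun t => (Real.exp_pos _).le) (hX.isSymm_sum ω)
  have e : ∫ ω, trace ((∑ k, X k ω ^ 2 + sumVar X μ) *
        (θ • NormedSpace.exp (θ • ∑ k, X k ω))) ∂μ =
      θ * (∫ ω, trace ((∑ k, X k ω ^ 2) * NormedSpace.exp (θ • ∑ k, X k ω)) ∂μ +
        ∫ ω, trace (sumVar X μ * NormedSpace.exp (θ • ∑ k, X k ω)) ∂μ) := by
    rw [← integral_add (hX.isBddMeas_sumSq.mul hE).integrable_trace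
      ((IsBddMeas.const _).mul hE).integrable_trace, ← integral_const_mul]
    refine integral_congr_ae (Filter.Eventually.of_forall fun ω => ?_)
    dsimp only
    rw [Matrix.mul_smul, trace_smul, Matrix.add_mul, trace_add, smul_eq_mul]
  rw [e] at h1 h2
  set Q := ∫ ω, trace ((∑ k, X k ω ^ 2) * NormedSpace.exp (θ • ∑ k, X k ω)) ∂μ
  set P := ∫ ω, trace (sumVar X μ * NormedSpace.exp (θ • ∑ k, X k ω)) ∂μ
  set M := ∫ ω, trace (NormedSpace.exp (θ • ∑ k, X k ω)) ∂μ
  set c := L / √2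
  have hc : 0 < 1 - c * θ := by linarith
  rw [div_mul_eq_mul_div, le_div_iff₀ hc]
  have h4 : (Q + P) * (1 - c * θ) ≤ 2 * (v * M) := by nlinarith
  calc _ ≤ 1 / 2 * (θ * (Q + P)) * (1 - c * θ) := mul_le_mul_of_nonneg_right h1 hc.le
    _ = 1 / 2 * θ * ((Q + P) * (1 - c * θ)) := by ring
    _ ≤ 1 / 2 * θ * (2 * (v * M)) := by gcongr
    _ = _ := by ring

theorem integral_trace_exp_le (hX : IsCenteredFamily X μ L) (hL : 0 < L) (hv0 : 0 ≤ v)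
    (hv : (v • (1 : Matrix (Fin d) (Fin d) ℝ) - sumVar X μ).PosSemidef) {θ : ℝ} (hθ : 0 ≤ θ)
    (hθL : L / √2 * θ < 1) :
    ∫ ω, trace (NormedSpace.exp (θ • ∑ k, X k ω)) ∂μ ≤
      d * Real.exp (v / (1 - L / √2 * θ) * (θ ^ 2 / 2)) := by
  set w := v / (1 - L / √2 * θ) with hw
  set M : ℝ → ℝ := fun t => ∫ ω, trace (NormedSpace.exp (t • ∑ k, X k ω)) ∂μ with hM
  have hd : ∀ t, HasDerivAt (fun t => M t * Real.exp (-(w * (t ^ 2 / 2))))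
      ((∫ ω, trace ((∑ k, X k ω) * NormedSpace.exp (t • ∑ k, X k ω)) ∂μ) *
        Real.exp (-(w * (t ^ 2 / 2))) + M t * (Real.exp (-(w * (t ^ 2 / 2))) * -(w * t))) t := by
    intro t
    refine (hasDerivAt_integral_trace_exp (hX.isBddMeas_sum _) t).mul (HasDerivAt.exp ?_)
    have := (((hasDerivAt_pow 2 t).div_const 2).const_mul w).neg
    exact this.congr_deriv (by norm_num)
  -- on `[0, θ]` the logarithmic derivative of `M` is at most that of `exp (w t² / 2)`
  have hanti : AntitoneOn (fun t => M t * Real.exp (-(w * (t ^ 2 / 2)))) (Set.Icc 0 θ) := by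
    refine antitoneOn_of_deriv_nonpos (convex_Icc 0 θ)
      (fun t _ => (hd t).continuousAt.continuousWithinAt)
      (fun t _ => (hd t).differentiableAt.differentiableWithinAt) fun t ht => ?_
    rw [interior_Icc] at ht
    rw [(hd t).deriv]
    have hc0 : 0 < L / √2 := by positivity
    have hlt : L / √2 * t ≤ L / √2 * θ := by gcongr; exact ht.2.le
    have h1 := hX.integral_trace_mul_exp_le hL hv ht.1.le (by linarith)
    have hM0 : 0 ≤ M t := integral_nonneg fun ω =>
      ((meanValuePair_exp ht.1.le).spectral_fst.posSemidef (fun t => (Real.exp_pos _).le)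
        (hX.isSymm_sum ω)).trace_nonneg
    have h2 : v * t / (1 - L / √2 * t) ≤ w * t := by
      rw [hw, div_mul_eq_mul_div v]
      have := ht.1
      exact div_le_div_of_nonneg_left (by positivity) (by linarith) (by linarith)
    have h3 := h1.trans (mul_le_mul_of_nonneg_right h2 hM0)
    have h4 := mul_le_mul_of_nonneg_right h3 (Real.exp_pos (-(w * (t ^ 2 / 2)))).le
    linarith
  have h0 : M 0 = d := by simp [hM, NormedSpace.exp_zero]
  have := hanti (Set.left_mem_Icc.2 hθ) (Set.right_mem_Icc.2 hθ) hθ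
  simp only [h0] at this
  rw [Real.exp_neg, ← div_eq_mul_inv, div_le_iff₀ (Real.exp_pos _)] at this
  simpa using this

/-- Matrix Bernstein inequality in expectation, with the constants given by exchangeable pairs. -/
theorem integral_norm_le (hX : IsCenteredFamily X μ L) (hL : 0 < L) (hd : 1 ≤ d) (hv0 : 0 < v)
    (hv : (v • (1 : Matrix (Fin d) (Fin d) ℝ) - sumVar X μ).PosSemidef) :
    ∫ ω, ‖∑ k, X k ω‖ ∂μ ≤ √(2 * v * Real.log (2 * d)) + L / √2 * Real.log (2 * d) := by
  have hdR : (1 : ℝ) ≤ d := by exact_mod_cast hd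
  have : Nonempty (Fin d) := ⟨⟨0, hd⟩⟩
  set Λ := Real.log (2 * d) with hΛ
  have hΛ0 : 0 < Λ := Real.log_pos (by linarith)
  set c := L / √2 with hc
  have hc0 : 0 < c := by positivity
  -- the value of `θ` that minimizes the bound
  set s := √(v / (2 * Λ)) with hs
  have hs0 : 0 < s := Real.sqrt_pos.2 (by positivity)
  set θ := (c + s)⁻¹ with hθ
  have hθ0 : 0 < θ := by positivity
  have h1c : 1 - c * θ = s * θ := by rw [hθ]; field_simp; ring
  have hθL : c * θ < 1 := by nlinarith [mul_pos hs0 hθ0]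
  have hS := hX.isBddMeas_sum Finset.univ
  have hp := meanValuePair_exp (d := d) hθ0.le
  have hexp : Continuous (NormedSpace.exp : Matrix (Fin d) (Fin d) ℝ → _) := continuous_exp_matrix
  have hE1 := hS.comp hp.continuous_fst
  have hE2 : IsBddMeas fun ω => NormedSpace.exp ((-θ) • ∑ k, X k ω) :=
    hS.comp (F := fun A => NormedSpace.exp ((-θ) • A)) (hexp.comp (continuous_const_smul _))
  have b1 := hX.integral_trace_exp_le hL hv0.le hv hθ0.le hθL
  have hvar : sumVar (fun k ω => -X k ω) μ = sumVar X μ := by simp [sumVar]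
  have b2 := hX.neg.integral_trace_exp_le hL hv0.le (by rwa [hvar]) hθ0.le hθL
  simp only [Finset.sum_neg_distrib, smul_neg, ← neg_smul] at b2
  have hpt : ∀ ω, Real.exp (θ * ‖∑ k, X k ω‖) ≤
      trace (NormedSpace.exp (θ • ∑ k, X k ω) + NormedSpace.exp ((-θ) • ∑ k, X k ω)) := fun ω =>
    ((isSpectral_exp θ).add (isSpectral_exp (-θ))).le_trace (φ := fun t => Real.exp (θ * t))
      (fun t => by positivity) (fun t => by
        rcases abs_choice t with h | h <;> rw [h]
        · linarith [Real.exp_pos (-θ * t)]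
        · rw [mul_neg, ← neg_mul]; linarith [Real.exp_pos (θ * t)])
      (hX.isSymm_sum ω)
  have hnorm : Integrable (fun ω => ‖∑ k, X k ω‖) μ := hS.integrable.norm
  obtain ⟨K, hK⟩ := hS.bdd
  have hexpint : Integrable (fun ω => Real.exp (θ * ‖∑ k, X k ω‖)) μ := by
    refine Integrable.of_bound ?_ (Real.exp (θ * K)) (Filter.Eventually.of_forall fun ω => ?_)
    · exact (Real.measurable_exp.comp (hS.measurable.norm.const_mul θ)).aestronglyMeasurable
    · rw [Real.norm_eq_abs, Real.abs_exp]
      exact Real.exp_le_exp.2 (by gcongr; exact hK ω)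
  have hJ : Real.exp (θ * ∫ ω, ‖∑ k, X k ω‖ ∂μ) ≤ ∫ ω, Real.exp (θ * ‖∑ k, X k ω‖) ∂μ := by
    rw [← integral_const_mul]
    exact convexOn_exp.map_integral_le Real.continuous_exp.continuousOn isClosed_univ
      (Filter.Eventually.of_forall fun _ => Set.mem_univ _) (hnorm.const_mul θ) hexpint
  have hI : ∫ ω, Real.exp (θ * ‖∑ k, X k ω‖) ∂μ ≤
      2 * d * Real.exp (v / (1 - c * θ) * (θ ^ 2 / 2)) := by
    refine (integral_mono hexpint (hE1.add hE2).integrable_trace hpt).trans ?_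
    simp only [trace_add]
    rw [integral_add hE1.integrable_trace hE2.integrable_trace]
    linarith
  have hlog := Real.log_le_log (Real.exp_pos _) (hJ.trans hI)
  rw [Real.log_exp, Real.log_mul (by positivity) (Real.exp_pos _).ne', Real.log_exp, ← hΛ, h1c]
    at hlog
  have hss : s * s = v / (2 * Λ) := Real.mul_self_sqrt (by positivity)
  have hv2 : v = 2 * Λ * (s * s) := by rw [hss]; field_simp
  have hsq : √(2 * v * Λ) = 2 * Λ * s := by
    rw [hv2, show 2 * (2 * Λ * (s * s)) * Λ = (2 * Λ * s) ^ 2 by ring]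
    exact Real.sqrt_sq (by positivity)
  have hθ2 : v / (s * θ) * (θ ^ 2 / 2) = Λ * s * θ := by
    rw [hv2]; field_simp
  rw [hθ2] at hlog
  rw [hsq]
  have h1 : Λ = θ * (Λ * (c + s)) := by rw [hθ]; field_simp
  have h2 : θ * ∫ ω, ‖∑ k, X k ω‖ ∂μ ≤ θ * (2 * Λ * s + c * Λ) := by linarith
  exact le_of_mul_le_mul_left h2 hθ0

end IsCenteredFamily

end ExponentialMoments
end Matrix

/-! ### Numerical comparisons -/

section Numerics

lemma mul_log_two_le_mul_log {d a b : ℕ} (h : 2 ^ a ≤ d ^ b) :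
    a * Real.log 2 ≤ b * Real.log d := by
  rw [← Real.log_pow, ← Real.log_pow]
  exact Real.log_le_log (by positivity) (by exact_mod_cast h)

lemma natCast_le_three_mul_log {d : ℕ} (h2 : 2 ≤ d) (h4 : d ≤ 4) :
    (d : ℝ) ≤ 3 * Real.log d := by
  have hl := Real.log_two_gt_d9
  interval_cases d
  · norm_num; linarith
  · have := mul_log_two_le_mul_log (d := 3) (a := 3) (b := 2) (by norm_num)
    have h3 : 1 ≤ Real.log 3 := by
      rw [Real.le_log_iff_exp_le (by norm_num)]
      exact Real.exp_one_lt_three.le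
    norm_num; linarith
  · have := mul_log_two_le_mul_log (d := 4) (a := 2) (b := 1) (by norm_num)
    norm_num at this ⊢; linarith

lemma natCast_le_three_mul_log_sq {d : ℕ} (h5 : 5 ≤ d) (h23 : d ≤ 23) :
    (d : ℝ) ≤ 3 * Real.log d ^ 2 := by
  have hl := Real.log_two_gt_d9
  -- the lower bound `t ≤ log c ≤ log d` is read off from `2 ^ a ≤ c ^ b`
  have key : ∀ (a b c : ℕ) (t : ℝ), 0 ≤ t → 2 ^ a ≤ c ^ b → c ≤ d → b * t ≤ a * 0.6931471803 →
      0 < b → (d : ℝ) ≤ 3 * t ^ 2 → (d : ℝ) ≤ 3 * Real.log d ^ 2 := by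
    intro a b c t ht hab hcd hbt hb hdt
    have h1 := mul_log_two_le_mul_log (hab.trans (Nat.pow_le_pow_left hcd b))
    have hb' : (0 : ℝ) < b := by exact_mod_cast hb
    have h2 : (a : ℝ) * 0.6931471803 ≤ a * Real.log 2 := by gcongr
    have h3 : t ≤ Real.log d := le_of_mul_le_mul_left (by linarith) hb'
    have := pow_le_pow_left₀ ht h3 2
    linarith
  rcases Nat.lt_or_ge d 8 with h | h
  · have : (d : ℝ) ≤ 7 := by exact_mod_cast Nat.le_of_lt_succ h
    exact key 23 10 5 1.59 (by norm_num) (by norm_num) h5 (by norm_num) (by norm_num)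
      (this.trans (by norm_num))
  rcases Nat.lt_or_ge d 13 with h' | h'
  · have : (d : ℝ) ≤ 12 := by exact_mod_cast Nat.le_of_lt_succ h'
    exact key 3 1 8 2.07 (by norm_num) (by norm_num) h (by norm_num) (by norm_num)
      (this.trans (by norm_num))
  rcases Nat.lt_or_ge d 16 with h'' | h''
  · have : (d : ℝ) ≤ 15 := by exact_mod_cast Nat.le_of_lt_succ h''
    exact key 7 2 12 2.42 (by norm_num) (by norm_num) (by omega) (by norm_num) (by norm_num)
      (this.trans (by norm_num))
  · have : (d : ℝ) ≤ 23 := by exact_mod_cast h23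
    exact key 4 1 16 2.772 (by norm_num) (by norm_num) h'' (by norm_num) (by norm_num)
      (this.trans (by norm_num))

lemma one_div_sqrt_two_bounds : 0.7071 ≤ 1 / √2 ∧ 1 / √2 ≤ 0.70711 := by
  have h1 : (1.41421 : ℝ) ≤ √2 := Real.le_sqrt_of_sq_le (by norm_num)
  have h2 : √2 ≤ 1.41422 := Real.sqrt_le_iff.2 ⟨by norm_num, by norm_num⟩
  constructor
  · rw [le_div_iff₀ (by positivity)]; linarith
  · rw [div_le_iff₀ (by positivity)]; linarith

variable {R σ l M : ℝ}

/-- Discarding from the target those summands that no case of the argument uses. -/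
lemma add_sqrt_le_target (hR : 0 < R) (hl : 0 ≤ l) (hM : 0 < M) :
    R * l / √2 + √(l * (3 * σ ^ 2 + 8.4 * R ^ 2)) ≤
      R * l / √2 + √2 * R ^ 2 + √((R + l) * (3 * σ ^ 2 + 2 * R ^ 3 + 7 * R ^ 2 + √2 * R ^ 2
        + 7 * R ^ 2 / M + 4 * R ^ 2 / M ^ 2)) := by
  have h1 : (1.4 : ℝ) ≤ √2 := Real.le_sqrt_of_sq_le (by norm_num)
  have h2 : √(l * (3 * σ ^ 2 + 8.4 * R ^ 2)) ≤ √((R + l) * (3 * σ ^ 2 + 2 * R ^ 3 + 7 * R ^ 2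
      + √2 * R ^ 2 + 7 * R ^ 2 / M + 4 * R ^ 2 / M ^ 2)) := by
    apply Real.sqrt_le_sqrt
    apply mul_le_mul (by linarith) _ (by positivity) (by positivity)
    have h3 : 1.4 * R ^ 2 ≤ √2 * R ^ 2 := by gcongr
    have h4 : 0 ≤ 7 * R ^ 2 / M := by positivity
    have h5 : 0 ≤ 4 * R ^ 2 / M ^ 2 := by positivity
    have h6 : 0 ≤ 2 * R ^ 3 := by positivity
    linarith
  have h3 : 0 ≤ √2 * R ^ 2 := by positivity
  linarith

lemma sqrt_mul_add_sqrt_mul_le {p q a b : ℝ} (hp : 0 ≤ p) (hq : 0 ≤ q) (ha : 0 ≤ a)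
    (hb : 0 ≤ b) : √(p * a) + √(q * b) ≤ √((p + q) * (a + b)) := by
  apply Real.le_sqrt_of_sq_le
  rw [Real.sqrt_mul hp, Real.sqrt_mul hq]
  have e1 := Real.sq_sqrt hp
  have e2 := Real.sq_sqrt hq
  have e3 := Real.sq_sqrt ha
  have e4 := Real.sq_sqrt hb
  generalize √p = x at *
  generalize √q = y at *
  generalize √a = z at *
  generalize √b = w at *
  subst e1 e2 e3 e4
  nlinarith [sq_nonneg (x * w - y * z)]

/-- The numerical comparison in large dimension. The variance proxy is
`σ ^ 2 + R ^ 2 / 4` rather than `σ ^ 2` so as to be positive even when `σ = 0`. If there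
are few summands, the trivial bound `M R` is below the target; otherwise `L = R (1 + 1 / M)` is
close enough to `R`. -/
lemma large_dim_bound {E : ℝ} (hR : 0 < R) (hl : 3.16 ≤ l) (hM : 0 < M) (hE : E ≤ M * R)
    (hE' : E ≤ R + (√(2 * (σ ^ 2 + R ^ 2 / 4) * (Real.log 2 + l)) +
      (R + R / M) / √2 * (Real.log 2 + l))) :
    E ≤ R * l / √2 + √(l * (3 * σ ^ 2 + 8.4 * R ^ 2)) := by
  obtain ⟨hs1, hs2⟩ := one_div_sqrt_two_bounds
  have hl1 := Real.log_two_gt_d9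
  have hl2 := Real.log_two_lt_d9
  set lam := Real.log 2
  set c := 1 / √2 with hc
  have hT0 : R * √(8.4 * l) ≤ √(l * (3 * σ ^ 2 + 8.4 * R ^ 2)) := by
    rw [← Real.sqrt_sq hR.le, ← Real.sqrt_mul (by positivity), Real.sqrt_sq hR.le]
    apply Real.sqrt_le_sqrt
    nlinarith [mul_nonneg (by linarith : 0 ≤ l) (sq_nonneg σ)]
  have e1 : R * l / √2 = R * (l * c) := by rw [hc]; ring
  -- what remains after cancelling `R l / √2` is at most `K R`, and `3 l = 2 (lam + l) + (l - 2 lam)`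
  -- leaves room for it under the root
  have main : ∀ K : ℝ, 0 ≤ K → K ^ 2 ≤ 2.55 * (l - 2 * lam) →
      1 + lam * c + c * (lam + l) / M ≤ K →
      E ≤ R * l / √2 + √(l * (3 * σ ^ 2 + 8.4 * R ^ 2)) := by
    intro K hK0 hK hle
    have h1 := sqrt_mul_add_sqrt_mul_le (p := 2 * (lam + l)) (q := l - 2 * lam)
      (a := σ ^ 2 + R ^ 2 / 4) (b := 2.55 * R ^ 2) (by linarith) (by linarith) (by positivity)
      (by positivity)
    have h2 : K * R ≤ √((l - 2 * lam) * (2.55 * R ^ 2)) := by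
      apply Real.le_sqrt_of_sq_le
      rw [mul_pow]
      nlinarith [mul_le_mul_of_nonneg_right hK (sq_nonneg R)]
    rw [show (2 * (lam + l) + (l - 2 * lam)) * (σ ^ 2 + R ^ 2 / 4 + 2.55 * R ^ 2) =
        l * (3 * σ ^ 2 + 8.4 * R ^ 2) by ring,
      show 2 * (lam + l) * (σ ^ 2 + R ^ 2 / 4) =
         2 * (σ ^ 2 + R ^ 2 / 4) * (lam + l) by ring] at h1
    have h3 : (R + R / M) / √2 * (lam + l) =
        R * (l * c) + R * (lam * c) + R * (c * (lam + l) / M) := by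
      rw [hc]; ring
    have h4 := mul_le_mul_of_nonneg_left hle hR.le
    rw [h3] at hE'
    rw [e1]
    nlinarith
  have hc0 : 0 < c := by linarith
  have hcc : c * c = 1 / 2 := by
    rw [hc, div_mul_div_comm, Real.mul_self_sqrt (by norm_num), one_mul]
  have hlamc : lam * c ≤ 0.4902 := by nlinarith
  -- the number of summands above which the trivial bound is given up: a larger one is affordable
  -- only while `l` is moderate, a smaller one suffices only once `l` is large
  rcases le_or_gt l 8 with h8 | h8
  · rcases le_or_gt (2 * c * (lam + l)) M with hm | hm
    · refine main 1.9902 (by norm_num) (by nlinarith) ?_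
      have : c * (lam + l) / M ≤ 1 / 2 := by rw [div_le_iff₀ hM]; linarith
      linarith
    · have h1 : 2 * c * (lam + l) - l * c ≤ √(8.4 * l) := by
        apply Real.le_sqrt_of_sq_le
        have h3 : 2 * c * (lam + l) - l * c ≤ 0.70711 * l + 0.9804 := by nlinarith
        have h4 : 0 ≤ 2 * c * (lam + l) - l * c := by nlinarith
        have := pow_le_pow_left₀ h4 h3 2
        nlinarith
      have h2 := mul_le_mul_of_nonneg_right (show M ≤ l * c + √(8.4 * l) by linarith) hR.le
      rw [e1]; nlinarith
  · rcases le_or_gt (c * (lam + l)) M with hm | hm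
    · refine main 2.4902 (by norm_num) (by nlinarith) ?_
      have : c * (lam + l) / M ≤ 1 := by rw [div_le_iff₀ hM]; linarith
      linarith
    · have h1 : (1 : ℝ) ≤ √(8.4 * l) := Real.le_sqrt_of_sq_le (by nlinarith)
      have h2 := mul_le_mul_of_nonneg_right (show M ≤ l * c + √(8.4 * l) by linarith) hR.le
      rw [e1]; nlinarith

end Numerics

/-! ### Truncation, centering, and the bound -/

namespace Matrix

section Truncation

variable {d : ℕ} {Ω : Type*} [MeasurableSpace Ω] {μ : Measure Ω}

/-- For integrable random matrices the entrywise expectation is the Bochner integral. -/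
lemma matrixExpectation_eq_integral {X : Ω → Matrix (Fin d) (Fin d) ℝ} (hX : Integrable X μ) :
    matrixExpectation μ X = ∫ ω, X ω ∂μ := by
  ext i j
  exact (LinearMap.toContinuousLinearMap (entryLinearMap ℝ ℝ i j)).integral_comp_comm hX

lemma matrixExpectation_congr {X Y : Ω → Matrix (Fin d) (Fin d) ℝ} (h : X =ᵐ[μ] Y) :
    matrixExpectation μ X = matrixExpectation μ Y := by
  ext i j
  exact integral_congr_ae (h.mono fun ω hω => by dsimp only; rw [hω])

open Classical in
/-- Replaces by zero every matrix that is not symmetric or whose matrix of absolute values has norm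
above `R`, so that bounds that hold almost surely hold everywhere. -/
noncomputable def truncSymm (R : ℝ) (A : Matrix (Fin d) (Fin d) ℝ) : Matrix (Fin d) (Fin d) ℝ :=
  if A.IsSymm ∧ ‖A.entryAbs‖ ≤ R then A else 0

lemma measurable_truncSymm (R : ℝ) :
    Measurable (truncSymm R : Matrix (Fin d) (Fin d) ℝ → Matrix (Fin d) (Fin d) ℝ) := by
  have h1 : IsClosed {A : Matrix (Fin d) (Fin d) ℝ | A.IsSymm} :=
    isClosed_eq continuous_id.matrix_transpose continuous_id
  have h2 : Continuous (entryAbs : Matrix (Fin d) (Fin d) ℝ → Matrix (Fin d) (Fin d) ℝ) :=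
    continuous_id.matrix_map continuous_abs
  have h3 : IsClosed {A : Matrix (Fin d) (Fin d) ℝ | ‖A.entryAbs‖ ≤ R} :=
    isClosed_le h2.norm continuous_const
  exact Measurable.ite (h1.inter h3).measurableSet measurable_id measurable_const

lemma isSymm_truncSymm (R : ℝ) (A : Matrix (Fin d) (Fin d) ℝ) : (truncSymm R A).IsSymm := by
  unfold truncSymm
  split_ifs with h
  · exact h.1
  · exact isSymm_zero

lemma norm_truncSymm_le {R : ℝ} (hR : 0 ≤ R) (A : Matrix (Fin d) (Fin d) ℝ) :
    ‖truncSymm R A‖ ≤ R := by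
  unfold truncSymm
  split_ifs with h
  · exact (norm_le_norm_entryAbs A).trans h.2
  · simpa using hR

end Truncation

section Final

variable {d m : ℕ} {Ω : Type*} [MeasurableSpace Ω]
  {X : Fin m → Ω → Matrix (Fin d) (Fin d) ℝ} {μ : Measure Ω} [IsProbabilityMeasure μ] {L v : ℝ}

/-- Jensen's inequality for powers of the norm. -/
lemma IsBddMeas.integral_norm_pow_le {S : Ω → Matrix (Fin d) (Fin d) ℝ} (hS : IsBddMeas S)
    (k : ℕ) : (∫ ω, ‖S ω‖ ∂μ) ^ k ≤ ∫ ω, ‖S ω‖ ^ k ∂μ := by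
  obtain ⟨K, hK⟩ := hS.bdd
  refine (convexOn_pow k).map_integral_le (continuous_pow k).continuousOn isClosed_Ici
    (Filter.Eventually.of_forall fun ω => norm_nonneg _) hS.integrable.norm ?_
  refine Integrable.of_bound (hS.measurable.norm.pow_const k).aestronglyMeasurable (K ^ k)
    (Filter.Eventually.of_forall fun ω => ?_)
  rw [Function.comp_apply, norm_pow, norm_norm]
  exact pow_le_pow_left₀ (norm_nonneg _) (hK ω) k

/-- An even moment of the norm is at most the trace moment. -/
lemma IsBddMeas.integral_norm_pow_le_trace (hd : 1 ≤ d) {S : Ω → Matrix (Fin d) (Fin d) ℝ}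
    (hS : IsBddMeas S) (hs : ∀ ω, (S ω).IsSymm) {k : ℕ} (hk : Even k) :
    (∫ ω, ‖S ω‖ ∂μ) ^ k ≤ ∫ ω, trace (S ω ^ k) ∂μ := by
  have : Nonempty (Fin d) := ⟨⟨0, hd⟩⟩
  refine (hS.integral_norm_pow_le k).trans ?_
  refine integral_mono_of_nonneg (Filter.Eventually.of_forall fun ω => by positivity)
    (hS.pow k).integrable_trace (Filter.Eventually.of_forall fun ω => ?_)
  exact (isSpectral_pow k).le_trace (φ := fun t => t ^ k) (fun t => hk.pow_nonneg t)
    (fun t => by rw [hk.pow_abs]) (hs ω)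

/-- The second moment of the norm of a shifted sum. Adding the mean inside the square, rather than
by the triangle inequality, avoids a term linear in `R`, for which dimension two has no room. -/
lemma IsCenteredFamily.integral_norm_sum_add_sq_le (hX : IsCenteredFamily X μ L) (hd : 1 ≤ d)
    (hv : (v • (1 : Matrix (Fin d) (Fin d) ℝ) - sumVar X μ).PosSemidef)
    {N : Matrix (Fin d) (Fin d) ℝ} (hN : N.IsSymm) {R : ℝ} (hNR : ‖N‖ ≤ R) :
    (∫ ω, ‖∑ k, X k ω + N‖ ∂μ) ^ 2 ≤ d * v + d * R ^ 2 := by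
  have hS := hX.isBddMeas_sum Finset.univ
  refine ((hS.add (.const N)).integral_norm_pow_le_trace hd
    (fun ω => (hX.isSymm_sum ω).add hN) even_two).trans ?_
  have e : ∀ ω, trace ((∑ k, X k ω + N) ^ 2) =
      trace ((∑ k, X k ω) ^ 2) + (2 * trace (N * ∑ k, X k ω) + trace (N ^ 2)) := by
    intro ω
    set s := ∑ k, X k ω
    have : (s + N) ^ 2 = s ^ 2 + s * N + N * s + N ^ 2 := by noncomm_ring
    rw [this]
    simp only [trace_add, trace_mul_comm s N]
    ring
  have i1 := (hS.pow 2).integrable_trace (μ := μ)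
  have i2 := (((IsBddMeas.const N).mul hS).integrable_trace (μ := μ)).const_mul 2
  have hN2 : trace (N ^ 2) ≤ d * R ^ 2 := by
    have h1 : ‖N ^ 2‖ ≤ R ^ 2 := by
      rw [sq, sq]
      exact (norm_mul_le _ _).trans (mul_le_mul hNR hNR (norm_nonneg _)
        ((norm_nonneg _).trans hNR))
    have := (hN.pow 2).trace_mul_le h1 (G := 1) PosSemidef.one
    simp only [Matrix.mul_one, trace_one, Fintype.card_fin] at this
    linarith
  simp only [e]
  rw [integral_add i1 (i2.fun_add (integrable_const _)), integral_add i2 (integrable_const _),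
    integral_const_mul, hS.integral_trace_mul_left, hX.integral_sum_eq_zero]
  simp only [Matrix.mul_zero, trace_zero, integral_const, probReal_univ, one_smul]
  linarith [hX.integral_trace_sq_le, trace_sumVar_le hv]

end Final

end Matrix

open Matrix in
/-- The bound for a family that is symmetric and bounded everywhere, split as centered family plus
constant mean. -/
lemma integral_norm_centered_add_le {Ω : Type*} [MeasurableSpace Ω] {μ : Measure Ω}
    [IsProbabilityMeasure μ] {d m : ℕ} (hd : 2 ≤ d) (hm : 1 ≤ m)
    {X : Fin m → Ω → Matrix (Fin d) (Fin d) ℝ} {R σ : ℝ} (hR : 0 < R)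
    (hX : IsCenteredFamily X μ (R + R / m))
    (hσ : ((σ ^ 2) • (1 : Matrix (Fin d) (Fin d) ℝ) - sumVar X μ).PosSemidef)
    {N : Matrix (Fin d) (Fin d) ℝ} (hN : N.IsSymm) (hNR : ‖N‖ ≤ R)
    (htriv : ∀ ω, ‖∑ k, X k ω + N‖ ≤ m * R) :
    ∫ ω, ‖∑ k, X k ω + N‖ ∂μ ≤
      R * Real.log d / √2 + √(Real.log d * (3 * σ ^ 2 + 8.4 * R ^ 2)) := by
  have hm' : (1 : ℝ) ≤ m := by exact_mod_cast hm
  have hd' : (2 : ℝ) ≤ d := by exact_mod_cast hd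
  have hl0 : 0 < Real.log d := Real.log_pos (by linarith)
  have hS := hX.isBddMeas_sum Finset.univ
  have hL : 0 < R + R / m := by positivity
  have htri : ∫ ω, ‖∑ k, X k ω + N‖ ∂μ ≤ R + ∫ ω, ‖∑ k, X k ω‖ ∂μ := by
    calc _ ≤ ∫ ω, (R + ‖∑ k, X k ω‖) ∂μ :=
          integral_mono (hS.add (.const N)).integrable.norm
            ((integrable_const _).add hS.integrable.norm) fun ω =>
            (norm_add_le _ _).trans (by rw [add_comm]; gcongr)
      _ = _ := by
        rw [integral_add (integrable_const _) hS.integrable.norm]; simp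
  rcases Nat.lt_or_ge d 5 with h5 | h5
  -- here `d ≤ 3 log d`, and the second trace moment suffices
  · have h1 := hX.integral_norm_sum_add_sq_le (by omega) hσ hN hNR
    have h2 := natCast_le_three_mul_log hd (Nat.le_of_lt_succ h5)
    have h3 : ∫ ω, ‖∑ k, X k ω + N‖ ∂μ ≤ √(Real.log d * (3 * σ ^ 2 + 8.4 * R ^ 2)) := by
      apply Real.le_sqrt_of_sq_le
      have := mul_le_mul_of_nonneg_right h2 (by positivity : 0 ≤ σ ^ 2 + R ^ 2)
      nlinarith [mul_pos hl0 (pow_pos hR 2)]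
    have : 0 ≤ R * Real.log d / √2 := by positivity
    linarith
  rcases Nat.lt_or_ge d 24 with h24 | h24
  -- here `d ≤ 3 (log d)²`, so the fourth trace moment suffices; `√2 ≤ log d` absorbs the mean
  · have h1 := hS.integral_norm_pow_le_trace (μ := μ) (by omega) hX.isSymm_sum
      (k := 4) (by decide)
    have h2 := hX.integral_trace_pow_four_le (sq_nonneg σ) hσ
    have h3 := natCast_le_three_mul_log_sq h5 (Nat.le_of_lt_succ h24)
    have hLR : (R + R / m) ^ 2 ≤ 4 * R ^ 2 := by
      have : R / m ≤ R := div_le_self hR.le hm'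
      calc (R + R / m) ^ 2 ≤ (R + R) ^ 2 := by gcongr
        _ = _ := by ring
    have h4 : ∫ ω, ‖∑ k, X k ω‖ ∂μ ≤ √(Real.log d * (3 * σ ^ 2 + 8.4 * R ^ 2)) := by
      apply Real.le_sqrt_of_sq_le
      refine (pow_le_pow_iff_left₀ (by positivity) (by positivity) two_ne_zero).1 ?_
      rw [← pow_mul]
      calc (∫ ω, ‖∑ k, X k ω‖ ∂μ) ^ 4
          ≤ 3 * d * (σ ^ 2) ^ 2 + 3 / 2 * d * (R + R / m) ^ 2 * σ ^ 2 := h1.trans h2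
        _ ≤ 3 * d * (σ ^ 2) ^ 2 + 3 / 2 * d * (4 * R ^ 2) * σ ^ 2 := by gcongr
        _ = 3 * d * ((σ ^ 2) ^ 2 + 2 * R ^ 2 * σ ^ 2) := by ring
        _ ≤ 3 * (3 * Real.log d ^ 2) * ((σ ^ 2) ^ 2 + 2 * R ^ 2 * σ ^ 2) := by gcongr
        _ ≤ 3 * (3 * Real.log d ^ 2) * (σ ^ 2 + 2.8 * R ^ 2) ^ 2 := by
          gcongr
          nlinarith [mul_nonneg (sq_nonneg R) (sq_nonneg σ), sq_nonneg (R ^ 2)]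
        _ = _ := by ring
    have h6 : R ≤ R * Real.log d / √2 := by
      rw [le_div_iff₀ (by positivity)]
      have : √2 ≤ Real.log d := by
        have h7 := mul_log_two_le_mul_log (a := 23) (b := 10) (d := d)
          (le_trans (by norm_num) (Nat.pow_le_pow_left h5 10))
        have := Real.log_two_gt_d9
        push_cast at h7
        exact Real.sqrt_le_iff.2 ⟨hl0.le, by nlinarith⟩
      gcongr
    linarith
  -- here `log (2 d)` is close enough to `log d` for the exponential moment bound
  · have hl : 3.16 ≤ Real.log d := by
      have := mul_log_two_le_mul_log (d := 24) (a := 32) (b := 7) (by norm_num)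
      have h24' : Real.log (24 : ℕ) ≤ Real.log d :=
        Real.log_le_log (by norm_num) (by exact_mod_cast h24)
      have := Real.log_two_gt_d9
      push_cast at *
      linarith
    refine large_dim_bound (M := m) hR hl (by linarith) ?_ ?_
    · calc _ ≤ ∫ _, (m * R : ℝ) ∂μ :=
            integral_mono (hS.add (.const N)).integrable.norm (integrable_const _) htriv
        _ = _ := by simp
    · have hv : ((σ ^ 2 + R ^ 2 / 4) • (1 : Matrix (Fin d) (Fin d) ℝ) -
          sumVar X μ).PosSemidef := by
        have h1 : ((R ^ 2 / 4) • (1 : Matrix (Fin d) (Fin d) ℝ)).PosSemidef :=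
          PosSemidef.one.smul (by positivity)
        convert hσ.add h1 using 1
        rw [add_smul]; abel
      have := hX.integral_norm_le hL (by omega) (by positivity) hv
      rw [Real.log_mul (by norm_num) (by positivity)] at this
      linarith

theorem lemma1 {Ω : Type*} [MeasurableSpace Ω] (μ : Measure Ω) [IsProbabilityMeasure μ]
    (d m : ℕ) (hd : 2 ≤ d) (hm : 1 ≤ m)
    (Y : Fin m → Ω → Matrix (Fin d) (Fin d) ℝ)
    (ε : Fin m → Matrix (Fin d) (Fin d) ℝ)
    (R : ℝ) (hR : 0 < R)
    (hmeas : ∀ k, Measurable (Y k))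
    (hindep : iIndepFun Y μ)
    (hsymm : ∀ k, ∀ᵐ ω ∂μ, (Y k ω).IsSymm)
    (hmean : ∀ k, matrixExpectation μ (Y k) = ε k)
    (hbound : ∀ k, ∀ᵐ ω ∂μ, ‖(Y k ω).entryAbs‖ ≤ R)
    (herr : ∀ k, ‖(ε k).entryAbs‖ ≤ R / (m : ℝ))
    (σ : ℝ)
    (hσ : σ ^ 2 = ‖∑ k, matrixExpectation μ (fun ω => Y k ω ^ 2)‖) :
    Integrable (fun ω => ‖∑ k, Y k ω‖) μ ∧
      ∫ ω, ‖∑ k, Y k ω‖ ∂μ ≤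
        R * Real.log (d : ℝ) / √2 + √2 * R ^ 2
          + √((R + Real.log (d : ℝ)) *
              (3 * σ ^ 2 + 2 * R ^ 3 + 7 * R ^ 2 + √2 * R ^ 2
                + 7 * R ^ 2 / (m : ℝ) + 4 * R ^ 2 / (m : ℝ) ^ 2)) := by
  have hm' : (1 : ℝ) ≤ m := by exact_mod_cast hm
  set T : Fin m → Ω → Matrix (Fin d) (Fin d) ℝ := fun k ω => Matrix.truncSymm R (Y k ω) with hT
  have hTm : ∀ k, Measurable (T k) := fun k => (Matrix.measurable_truncSymm R).comp (hmeas k)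
  have hTb : ∀ k, Matrix.IsBddMeas (T k) := fun k =>
    ⟨hTm k, R, fun ω => Matrix.norm_truncSymm_le hR.le _⟩
  have hTs : ∀ k ω, (T k ω).IsSymm := fun k ω => Matrix.isSymm_truncSymm R _
  have hYT : ∀ k, Y k =ᵐ[μ] T k := fun k => by
    filter_upwards [hsymm k, hbound k] with ω h1 h2
    simp only [hT, Matrix.truncSymm, if_pos (And.intro h1 h2)]
  have hε : ∀ k, ε k = ∫ ω, T k ω ∂μ := fun k => by
    rw [← hmean k, Matrix.matrixExpectation_congr (hYT k),
      Matrix.matrixExpectation_eq_integral (hTb k).integrable]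
  have hεs : ∀ k, (ε k).IsSymm := fun k => by
    rw [hε k]; exact (hTb k).isSymm_integral (hTs k)
  have hεn : ∀ k, ‖ε k‖ ≤ R / m := fun k => (Matrix.norm_le_norm_entryAbs _).trans (herr k)
  set X : Fin m → Ω → Matrix (Fin d) (Fin d) ℝ := fun k ω => T k ω - ε k with hXdef
  have hX : Matrix.IsCenteredFamily X μ (R + R / m) :=
    { measurable := fun k => (hTm k).sub measurable_const
      isSymm := fun k ω => (hTs k ω).sub (hεs k)
      norm_le := fun k ω =>
        norm_sub_le_of_le (Matrix.norm_truncSymm_le hR.le _) (hεn k)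
      integral_eq_zero := fun k => by
        simp only [hXdef]
        rw [integral_sub (hTb k).integrable (integrable_const _), ← hε k]
        simp
      indep := hindep.comp (fun k A => Matrix.truncSymm R A - ε k) fun k =>
        (Matrix.measurable_truncSymm R).sub measurable_const }
  set N := ∑ k, ε k with hNdef
  have hN : N.IsSymm := Matrix.IsCenteredFamily.isSymm_finsetSum _ hεs
  have hNR : ‖N‖ ≤ R := by
    calc ‖N‖ ≤ ∑ _k : Fin m, R / m := norm_sum_le_of_le _ fun k _ => hεn k
      _ = R := by
        rw [Finset.sum_const, Finset.card_univ, Fintype.card_fin, nsmul_eq_mul]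
        field_simp
  have hXN : ∀ ω, ∑ k, X k ω + N = ∑ k, T k ω := fun ω => by
    simp only [hXdef, Finset.sum_sub_distrib, hNdef, sub_add_cancel]
  have hae : (fun ω => ‖∑ k, Y k ω‖) =ᵐ[μ] fun ω => ‖∑ k, X k ω + N‖ := by
    filter_upwards [ae_all_iff.2 hYT] with ω hω
    rw [hXN]
    simp only [hω]
  -- centering only decreases the matrix variance
  have hvar : ((σ ^ 2) • (1 : Matrix (Fin d) (Fin d) ℝ) - Matrix.sumVar X μ).PosSemidef := by
    have h1 : ∑ k, matrixExpectation μ (fun ω => Y k ω ^ 2) = ∑ k, ∫ ω, T k ω ^ 2 ∂μ :=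
      Finset.sum_congr rfl fun k _ => by
        rw [← Matrix.matrixExpectation_eq_integral ((hTb k).pow 2).integrable]
        exact Matrix.matrixExpectation_congr ((hYT k).mono fun ω hω => congrArg (· ^ 2) hω)
    rw [h1] at hσ
    have h2 : ∀ k, ∫ ω, X k ω ^ 2 ∂μ = ∫ ω, T k ω ^ 2 ∂μ - ε k ^ 2 := fun k => by
      have e : ∀ ω, X k ω ^ 2 = T k ω ^ 2 - (T k ω * ε k + ε k * T k ω - ε k ^ 2) := fun ω => by
        simp only [hXdef]; noncomm_ring
      have i1 := ((hTb k).pow 2).integrable (μ := μ)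
      have i2 := ((hTb k).mul (.const (ε k))).integrable (μ := μ)
      have i3 := ((Matrix.IsBddMeas.const (ε k)).mul (hTb k)).integrable (μ := μ)
      have i4 : Integrable (fun ω => T k ω * ε k + ε k * T k ω - ε k ^ 2) μ :=
        (i2.add i3).sub (integrable_const _)
      simp only [e]
      rw [integral_sub i1 i4, integral_sub (i2.fun_add i3) (integrable_const _), integral_add i2 i3,
        integral_mul_const_of_integrable (hTb k).integrable,
        integral_const_mul_of_integrable (hTb k).integrable, ← hε k]
      simp only [integral_const, probReal_univ, one_smul]
      noncomm_ring
    have h3 : (∑ k, ∫ ω, T k ω ^ 2 ∂μ).IsSymm :=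
      Matrix.IsCenteredFamily.isSymm_finsetSum _ fun k =>
        ((hTb k).pow 2).isSymm_integral fun ω => (hTs k ω).pow 2
    have h4 := h3.posSemidef_smul_one_sub hσ.ge
    have h5 : (∑ k, ε k ^ 2).PosSemidef :=
      Matrix.posSemidef_sum _ fun k _ => (hεs k).posSemidef_sq
    convert h4.add h5 using 1
    rw [Matrix.sumVar, Finset.sum_congr rfl fun k _ => h2 k, Finset.sum_sub_distrib]
    abel
  have hint : Integrable (fun ω => ‖∑ k, X k ω + N‖) μ :=
    ((hX.isBddMeas_sum _).add (.const N)).integrable.norm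
  refine ⟨hint.congr hae.symm, ?_⟩
  rw [integral_congr_ae hae]
  have htriv : ∀ ω, ‖∑ k, X k ω + N‖ ≤ m * R := fun ω => by
    rw [hXN]
    calc _ ≤ ∑ _k : Fin m, R := norm_sum_le_of_le _ fun k _ => Matrix.norm_truncSymm_le hR.le _
      _ = _ := by simp
  exact (integral_norm_centered_add_le hd hm hR hX hvar hN hNR htriv).trans
    (add_sqrt_le_target hR (Real.log_nonneg (by exact_mod_cast (by omega : 1 ≤ d))) (by linarith))
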